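/- All groups and sets are finite. Let $\Omega$ be a finite set. **Definitions.** A transitive permutation group $G\le\mathrm{Sym}(\Omega)$ is *quasiprimitive* if all its non-trivial normal subgroups are transitive. $\mathrm{Soc}\,G$ denotes the subgroup generated by the minimal normal subgroups of $G$. A subgroup $H$ of a group $M$ is *subdirect* if it projects onto every factor of the unique finest direct decomposition of $M$ (when $M$ has one, as does every non-abelian minimal normal subgroup of a finite group). Let $G$ be quasiprimitive on $\Omega$, $M$ a minimal normal subgroup of $G$, and $\omega\in\Omega$. Then $G$ has * type HA if $M$ is abelian, $C_G(M)=M$ and $G\le\mathrm{Hol}\,M$ (i.e. $M$ is regular and $G\leq N_{\mathrm{Sym}(\Omega)}(M)$); * type Sd if $M$ is non-abelian and non-simple, $C_G(M)=1$, and $M_\omega$ is a simple subdirect subgroup of $M$; * type Cd if $M$ is non-abelian and non-simple, $C_G(M)=1$, and $M_\omega$ is a non-simple subdirect subgroup of $M$. A *Cartesian decomposition* of $\Omega$ is a set $\mathcal E=\{\Gamma_1,\dots,\Gamma_\ell\}$ of proper partitions of $\Omega$ (neither the one-part partition nor the partition into singletons) with $|\gamma_1\cap\dots\cap\gamma_\ell|=1$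 for all $\gamma_1\in\Gamma_1,\dots,\gamma_\ell\in\Gamma_\ell$; it is *homogeneous* if $|\Gamma|$ is the same for all $\Gamma\in\mathcal E$, and *$G$-invariant* if its partitions are permuted by $G$. For $\Gamma\in\mathcal E$ the *component* $G^\Gamma\le\mathrm{Sym}(\Gamma)$ is the permutation group induced on $\Gamma$ by the stabiliser $G_\Gamma$ of $\Gamma$ in $G$. If $L_\Gamma\le\mathrm{Sym}(\Gamma)$ for each $\Gamma\in\mathcal E$, then $\prod_{\Gamma\in\mathcal E}L_\Gamma$ is regarded as a subgroup of $\mathrm{Sym}(\Omega)$ through its product action on $\prod_{\Gamma\in\mathcal E}\Gamma$, which is identified with $\Omega$ by $(\gamma_\Gamma)_{\Gamma}\mapsto\bigcap_\Gamma\gamma_\Gamma$. If $M\le\mathrm{Sym}(\Omega)$ is transitive and leaves every $\Gamma\in\mathcal E$ invariant, then $\mathcal E$ is *$M$-normal* if, for each $\Gamma\in\mathcal E$, $M$ is the direct product of a normal subgroup and the kernel of its action on $\Gamma$, and $M=\prod_{\Gamma\in\mathcal E}M^\Gamma$. A $G$-invariant Cartesian decomposition $\mathcal E$ is a *blow-up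 decomposition* for $G$ if $G$ is transitive on $\mathcal E$ and there is a transitive normal subgroup $M$ of $G$ such that $\mathcal E$ is $M$-normal and $M^\Gamma=\mathrm{Soc}(G^\Gamma)$ for all $\Gamma\in\mathcal E$. **Theorem.** Let $G\le\mathrm{Sym}(\Omega)$ be a transitive permutation group, let $\mathcal E$ be a homogeneous $G$-invariant Cartesian decomposition of $\Omega$, and let $\Gamma_0\in\mathcal E$. Then the following all hold. (a) If $\mathcal E$ is a blow-up decomposition for $G$ and $G$ is quasiprimitive on $\Omega$, then the component $G^{\Gamma_0}$ is quasiprimitive on $\Gamma_0$ and $\mathrm{Soc}\,G=\prod_{\Gamma\in\mathcal E}\mathrm{Soc}(G^\Gamma)$. (b) If $\mathcal E$ is a blow-up decomposition for $G$ and the component $G^{\Gamma_0}$ is quasiprimitive on $\Gamma_0$ but not of type HA, then $G$ is quasiprimitive on $\Omega$ and $\mathrm{Soc}\,G=\prod_{\Gamma\in\mathcal E}\mathrm{Soc}(G^\Gamma)$. (c) $G$ is not quasiprimitive of type Sd. (d) If $G$ is quasiprimitive of type Cd, then $\mathcal E$ is a blow-up decomposition for $G$ and the component $G^{\Gamma_0}$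 is quasiprimitive of type Sd or Cd. -/

import Mathlib

/-! Permutation groups are subgroups of `Equiv.Perm Ω`, acting on `Ω` in the natural way.
Partitions of `Ω` are represented by equivalence relations `r : Setoid Ω`; the set of parts
of the partition is `Quotient r`. -/

namespace PermCartesian

/-! ### Minimal normal subgroups, socles, direct decompositions, subdirect subgroups -/

/-- `N` is a minimal normal subgroup of `G`: minimal among the non-trivial normal subgroups. -/
def IsMinimalNormal {G : Type*} [Group G] (N : Subgroup G) : Prop :=
  Minimal (fun K : Subgroup G => K.Normal ∧ K ≠ ⊥) N

/-- The socle of a group: the subgroup generated by its minimal normal subgroups. -/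
def socle (G : Type*) [Group G] : Subgroup G :=
  sSup {N | IsMinimalNormal N}

/-- The socle of a permutation group, as a permutation group. -/
def permSocle {Ω : Type*} (G : Subgroup (Equiv.Perm Ω)) : Subgroup (Equiv.Perm Ω) :=
  (socle G).map G.subtype

/-- `G` is the internal direct product of the set `D` of non-trivial subgroups. -/
structure IsDirectDecomposition {G : Type*} [Group G] (D : Set (Subgroup G)) : Prop where
  normal : ∀ K ∈ D, K.Normal
  ne_bot : ∀ K ∈ D, K ≠ ⊥
  indep : sSupIndep D
  sSup_eq_top : sSup D = ⊤

/-- A direct decomposition that refines every direct decomposition of the group. -/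
def IsFinestDirectDecomposition {G : Type*} [Group G] (D : Set (Subgroup G)) : Prop :=
  IsDirectDecomposition D ∧
    ∀ D' : Set (Subgroup G), IsDirectDecomposition D' → ∀ K ∈ D, ∃ K' ∈ D', K ≤ K'

/-- `H` is a subdirect subgroup of `M` with respect to the finest direct decomposition `D` of `M`:
for every factor `K ∈ D`, the projection of `H` to `K` along the product of the other factors
is onto. -/
def IsSubdirect {M : Type*} [Group M] (H : Subgroup M) : Prop :=
  ∃ D : Set (Subgroup M), IsFinestDirectDecomposition D ∧
    ∀ K ∈ D, ∀ k ∈ K, ∃ h ∈ H, ∃ c ∈ sSup (D \ {K}), h = k * c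

/-! ### Types of quasiprimitive groups

Quasiprimitivity of `G` on `Ω` is `MulAction.IsQuasiPreprimitive G Ω`: the action is transitive,
and so is that of every normal subgroup acting non-trivially. -/

/-- `G` is a quasiprimitive group of type HA: a minimal normal subgroup `M` is abelian and
self-centralising, and `G` is contained in the holomorph of `M`, that is, `M` is regular and `G`
is contained in the normaliser of `M` in the symmetric group. -/
def IsQuasiprimitiveHA {Ω : Type*} (G : Subgroup (Equiv.Perm Ω)) : Prop :=
  MulAction.IsQuasiPreprimitive G Ω ∧
    ∃ M : Subgroup G, IsMinimalNormal M ∧ IsMulCommutative M ∧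
      Subgroup.centralizer (M : Set G) = M ∧
      MulAction.IsPretransitive M Ω ∧ (∀ ω : Ω, MulAction.stabilizer M ω = ⊥) ∧
      G ≤ Subgroup.normalizer (M.map G.subtype : Set (Equiv.Perm Ω))

/-- `G` is a quasiprimitive group of type Sd: a minimal normal subgroup `M` is non-abelian and
non-simple with trivial centraliser, and its point stabilisers are simple subdirect subgroups. -/
def IsQuasiprimitiveSd {Ω : Type*} (G : Subgroup (Equiv.Perm Ω)) : Prop :=
  MulAction.IsQuasiPreprimitive G Ω ∧
    ∃ M : Subgroup G, IsMinimalNormal M ∧ ¬ IsMulCommutative M ∧ ¬ IsSimpleGroup M ∧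
      Subgroup.centralizer (M : Set G) = ⊥ ∧
      ∀ ω : Ω, IsSimpleGroup (MulAction.stabilizer M ω) ∧
        IsSubdirect (MulAction.stabilizer M ω)

/-- `G` is a quasiprimitive group of type Cd: a minimal normal subgroup `M` is non-abelian and
non-simple with trivial centraliser, and its point stabilisers are non-simple subdirect
subgroups. -/
def IsQuasiprimitiveCd {Ω : Type*} (G : Subgroup (Equiv.Perm Ω)) : Prop :=
  MulAction.IsQuasiPreprimitive G Ω ∧
    ∃ M : Subgroup G, IsMinimalNormal M ∧ ¬ IsMulCommutative M ∧ ¬ IsSimpleGroup M ∧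
      Subgroup.centralizer (M : Set G) = ⊥ ∧
      ∀ ω : Ω, ¬ IsSimpleGroup (MulAction.stabilizer M ω) ∧
        IsSubdirect (MulAction.stabilizer M ω)

/-! ### Cartesian decompositions -/

/-- A Cartesian decomposition of `Ω`: a set of proper partitions (neither the partition into
singletons nor the partition with at most one part) such that any choice of one part from each
partition has exactly one point in common. -/
structure IsCartesianDecomposition {Ω : Type*} (E : Set (Setoid Ω)) : Prop where
  proper : ∀ r ∈ E, r ≠ ⊥ ∧ r ≠ ⊤
  existsUnique : ∀ γ : (∀ r : E, Quotient r.1), ∃! ω : Ω, ∀ r : E, Quotient.mk r.1 ω = γ r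

/-- All partitions in `E` have the same number of parts. -/
def IsHomogeneous {Ω : Type*} (E : Set (Setoid Ω)) : Prop :=
  ∀ r ∈ E, ∀ s ∈ E, Nat.card (Quotient r) = Nat.card (Quotient s)

/-- The image of the partition `r` under the permutation `g`: `g x` and `g y` lie in the same part
of the image if and only if `x` and `y` lie in the same part of `r`. -/
def mapPartition {Ω : Type*} (g : Equiv.Perm Ω) (r : Setoid Ω) : Setoid Ω :=
  r.comap g.symm

/-- The partitions in `E` are permuted by `G`. -/
def IsInvariant {Ω : Type*} (G : Subgroup (Equiv.Perm Ω)) (E : Set (Setoid Ω)) : Prop :=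
  ∀ g ∈ G, ∀ r ∈ E, mapPartition g r ∈ E

/-- `G` is transitive on `E`. -/
def IsTransitiveOn {Ω : Type*} (G : Subgroup (Equiv.Perm Ω)) (E : Set (Setoid Ω)) : Prop :=
  ∀ r ∈ E, ∀ s ∈ E, ∃ g ∈ G, mapPartition g r = s

/-- The permutations of `Ω` that leave the partition `r` invariant. -/
def partitionStabilizer {Ω : Type*} (r : Setoid Ω) : Subgroup (Equiv.Perm Ω) where
  carrier := {g | ∀ x y, r x y ↔ r (g x) (g y)}
  one_mem' := fun _ _ => Iff.rfl
  mul_mem' := fun {a b} ha hb x y => (hb x y).trans (ha (b x) (b y))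
  inv_mem' := fun {a} ha x y => by
    have h := ha (a⁻¹ x) (a⁻¹ y)
    rw [show a (a⁻¹ x) = x from a.apply_symm_apply x,
      show a (a⁻¹ y) = y from a.apply_symm_apply y] at h
    exact h.symm

theorem mem_partitionStabilizer_iff {Ω : Type*} (r : Setoid Ω) (g : Equiv.Perm Ω) :
    g ∈ partitionStabilizer r ↔ mapPartition g r = r := by
  constructor
  · intro h
    ext x y
    have h1 := h (g.symm x) (g.symm y)
    simp only [Equiv.apply_symm_apply] at h1
    exact h1
  · intro h x y
    have h1 : (mapPartition g r) (g x) (g y) ↔ r (g x) (g y) := by rw [h]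
    have h2 : (mapPartition g r) (g x) (g y) ↔ r (g.symm (g x)) (g.symm (g y)) := Iff.rfl
    simp only [Equiv.symm_apply_apply] at h2
    exact h2.symm.trans h1

/-- The action on the set of parts of `r` of the permutations leaving `r` invariant. -/
def partAction {Ω : Type*} (r : Setoid Ω) :
    partitionStabilizer r →* Equiv.Perm (Quotient r) where
  toFun g := Quotient.congr g.1 g.2
  map_one' := by
    ext q
    induction q using Quotient.inductionOn with
    | h x => rfl
  map_mul' := fun a b => by
    ext q
    induction q using Quotient.inductionOn with
    | h x => rfl

/-- The component of `G` at the partition `r`: the permutation group induced on the set of parts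
of `r` by the stabiliser of `r` in `G`. -/
def component {Ω : Type*} (G : Subgroup (Equiv.Perm Ω)) (r : Setoid Ω) :
    Subgroup (Equiv.Perm (Quotient r)) :=
  (G.subgroupOf (partitionStabilizer r)).map (partAction r)

/-- The direct product of permutation groups `L r` on the sets of parts of `r`, for `r ∈ E`, as a
permutation group on `Ω`, for a Cartesian decomposition `E`. It acts in product action on `Ω`,
identified with the Cartesian product of the sets of parts: it consists of the permutations
that leave each `r ∈ E` invariant and induce on the set of its parts an element of `L r`.
The factor `L r` is identified with the group of those elements of the product that act
trivially on the parts of all the other partitions in `E`. -/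
def directProduct {Ω : Type*} (E : Set (Setoid Ω))
    (L : ∀ r : Setoid Ω, Subgroup (Equiv.Perm (Quotient r))) : Subgroup (Equiv.Perm Ω) :=
  ⨅ r ∈ E, ((L r).comap (partAction r)).map (partitionStabilizer r).subtype

/-- `E` is `M`-normal: `M` is transitive on `Ω`, it fixes each `r ∈ E`, for each `r ∈ E` it is the
direct product of a normal subgroup and the kernel of its action on the parts of `r`, and it is
the direct product of the groups it induces on the sets of parts of the `r ∈ E`. -/
structure IsNormalFor {Ω : Type*} (M : Subgroup (Equiv.Perm Ω)) (E : Set (Setoid Ω)) : Prop where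
  transitive : MulAction.IsPretransitive M Ω
  fixes : ∀ r ∈ E, M ≤ partitionStabilizer r
  complement : ∀ r ∈ E, ∃ N : Subgroup M, N.Normal ∧
    IsCompl N (((partAction r).ker.map (partitionStabilizer r).subtype).subgroupOf M)
  eq_directProduct : M = directProduct E (component M)

/-- `E` is a blow-up decomposition for `G`: it is transitive, and it is `M`-normal for
some transitive normal subgroup `M` of `G` that induces on the parts of each `r ∈ E` the socle of
the component of `G`. -/
def IsBlowUp {Ω : Type*} (G : Subgroup (Equiv.Perm Ω)) (E : Set (Setoid Ω)) : Prop :=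
  IsCartesianDecomposition E ∧ IsInvariant G E ∧ IsTransitiveOn G E ∧
    ∃ M : Subgroup (Equiv.Perm Ω), M ≤ G ∧ (M.subgroupOf G).Normal ∧ IsNormalFor M E ∧
      ∀ r ∈ E, component M r = permSocle (component G r)

end PermCartesian

namespace PermCartesian

/-! ### Centreless groups generated by their minimal normal subgroups -/

section MinimalNormal

variable {M : Type*} [Group M]

/-! Parts (a) and (b) rest on passing between `G` and its component by commutators. Let `M` be the
normal subgroup of a blow-up decomposition. If `N ≤ M` is normal in `G`, the commutator of an
element of `N` with an element of `M` acting on one partition only lies in `N` and again acts on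
that partition only (`component_localPart_ne_bot`). So `N` contains elements supported on a single
coordinate. They induce a normal subgroup of the component, and transitivity or largeness there
spreads over all coordinates because `G` permutes these transitively. In the other direction, a
normal subgroup of the component lifts to a normal subgroup of `G` (`normalLift`). If the component
has an abelian minimal normal subgroup and `G` is quasiprimitive, then `M` is abelian, and it lies
in every transitive subgroup of itself by self-centralisation.

Parts (c) and (d) rest on counting in the plinth `M`, the direct product of `k` minimal normal
subgroups `T`, which are conjugate in `G`; put `t = |M : C(T)|`. A subgroup `K` projecting onto
every `T` has order `t ^ κ`, where `κ` is the number of distinct kernels of its projections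
(`card_eq_pow`), and `T ≤ K` exactly when the kernel at `T` occurs for no other factor
(`le_iff_isolated`). Hence the factors outside `K` share kernels at least in pairs and number at
most `2 (k - κ)`.

Homogeneity makes `M` fix every partition. A point stabiliser then has index equal to the product of
the indices of the part stabilisers, all of which are subdirect. Taking exponents of `t`, the pairs
(factor, partition) with non-trivial action number fewer than `2 k`. As `G` is transitive on the
factors, each acts non-trivially on at most one partition (`eq_of_not_le_ker`). So `M` splits along
the decomposition, and `G` is transitive on it because it is transitive on the factors. That
subdirect subgroups are self-normalising (`mem_of_forall_conj_mem`) makes the centraliser of the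
group induced by `M` trivial, so that this group is the socle of the component. -/

theorem IsMinimalNormal.normal {T : Subgroup M} (hT : IsMinimalNormal T) : T.Normal := hT.1.1

theorem IsMinimalNormal.ne_bot {T : Subgroup M} (hT : IsMinimalNormal T) : T ≠ ⊥ := hT.1.2

theorem IsMinimalNormal.eq_of_le {T K : Subgroup M} (hT : IsMinimalNormal T) (hK : K.Normal)
    (hK' : K ≠ ⊥) (h : K ≤ T) : K = T :=
  le_antisymm h (hT.2 ⟨hK, hK'⟩ h)

theorem IsMinimalNormal.le_or_disjoint {T K : Subgroup M} (hT : IsMinimalNormal T)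
    (hK : K.Normal) : T ≤ K ∨ Disjoint T K := by
  by_cases h : T ⊓ K = ⊥
  · exact Or.inr (disjoint_iff.2 h)
  · have := hT.normal
    left
    rw [← hT.eq_of_le inferInstance h inf_le_left]
    exact inf_le_right

theorem le_centralizer_of_disjoint {T K : Subgroup M} (hT : T.Normal) (hK : K.Normal)
    (h : Disjoint T K) : T ≤ Subgroup.centralizer (K : Set M) := by
  intro x hx
  rw [Subgroup.mem_centralizer_iff]
  intro y hy
  exact (Subgroup.commute_of_normal_of_disjoint T K hT hK h x y hx hy).symm

theorem IsMinimalNormal.le_or_le_centralizer {T K : Subgroup M} (hT : IsMinimalNormal T)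
    (hK : K.Normal) : T ≤ K ∨ T ≤ Subgroup.centralizer (K : Set M) :=
  (hT.le_or_disjoint hK).imp_right (le_centralizer_of_disjoint hT.normal hK)

theorem IsMinimalNormal.le_centralizer {T T' : Subgroup M} (hT : IsMinimalNormal T)
    (hT' : IsMinimalNormal T') (h : T ≠ T') : T ≤ Subgroup.centralizer (T' : Set M) :=
  (hT.le_or_le_centralizer hT'.normal).resolve_left
    fun h' => h (hT'.eq_of_le hT.normal hT.ne_bot h')

theorem exists_isMinimalNormal_le [Finite M] {K : Subgroup M} (hK : K.Normal) (hK' : K ≠ ⊥) :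
    ∃ T, IsMinimalNormal T ∧ T ≤ K := by
  obtain ⟨T, hTK, hT⟩ := (Set.toFinite {K : Subgroup M | K.Normal ∧ K ≠ ⊥}).exists_le_minimal
    (show K ∈ {K : Subgroup M | K.Normal ∧ K ≠ ⊥} from ⟨hK, hK'⟩)
  exact ⟨T, hT, hTK⟩

theorem IsMinimalNormal.map_mulEquiv {M' : Type*} [Group M'] {T : Subgroup M}
    (hT : IsMinimalNormal T) (e : M ≃* M') : IsMinimalNormal (T.map e.toMonoidHom) := by
  refine ⟨⟨hT.normal.map _ e.surjective, fun h => hT.ne_bot ?_⟩, fun K hK hle => ?_⟩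
  · rwa [Subgroup.map_eq_bot_iff_of_injective _ e.injective] at h
  · have h1 : K.comap e.toMonoidHom = T := by
      refine hT.eq_of_le (hK.1.comap _) (fun h => hK.2 ?_) ?_
      · rw [← Subgroup.map_comap_eq_self_of_surjective (f := e.toMonoidHom) e.surjective K, h,
          Subgroup.map_bot]
      · rw [← Subgroup.comap_map_eq_self_of_injective (f := e.toMonoidHom) e.injective T]
        exact Subgroup.comap_mono hle
    rw [← h1]
    exact Subgroup.map_comap_le _ _

theorem IsMinimalNormal.sSup_le_centralizer {T : Subgroup M} (hT : IsMinimalNormal T) :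
    sSup ({T | IsMinimalNormal T} \ {T}) ≤ Subgroup.centralizer (T : Set M) :=
  sSup_le fun _ hT' => hT'.1.le_centralizer hT hT'.2

/-- A group with trivial centre that is generated by its minimal normal subgroups. -/
structure IsCenterlessSocle (M : Type*) [Group M] : Prop where
  center_eq_bot : Subgroup.center M = ⊥
  socle_eq_top : socle M = ⊤

namespace IsCenterlessSocle

variable (hM : IsCenterlessSocle M)

include hM

/-- The minimal normal subgroups generate `M`, so such an `x` is central. This is how most
intersections below are shown to be trivial. -/
theorem eq_one_of_forall_commute {x : M}
    (h : ∀ T : Subgroup M, IsMinimalNormal T → x ∈ Subgroup.centralizer (T : Set M)) : x = 1 := by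
  have h1 : socle M ≤ Subgroup.centralizer {x} := by
    refine sSup_le fun T hT t ht => ?_
    rw [Subgroup.mem_centralizer_singleton_iff]
    exact Subgroup.mem_centralizer_iff.1 (h T hT) t ht
  rw [← Subgroup.mem_bot, ← hM.center_eq_bot, Subgroup.mem_center_iff]
  intro g
  have h2 : g ∈ Subgroup.centralizer {x} := h1 (by rw [hM.socle_eq_top]; trivial)
  exact Subgroup.mem_centralizer_singleton_iff.1 h2

/-- An abelian `T` would commute with itself and with every other minimal normal subgroup, hence be
central. -/
theorem not_le_centralizer_self {T : Subgroup M} (hT : IsMinimalNormal T) :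
    ¬ T ≤ Subgroup.centralizer (T : Set M) := by
  intro h
  refine hT.ne_bot ((Subgroup.eq_bot_iff_forall _).2 fun x hx =>
    hM.eq_one_of_forall_commute fun T' hT' => ?_)
  by_cases hTT : T = T'
  · exact hTT ▸ h hx
  · exact hT.le_centralizer hT' hTT hx

theorem inf_centralizer {T : Subgroup M} (hT : IsMinimalNormal T) :
    T ⊓ Subgroup.centralizer (T : Set M) = ⊥ := by
  have := hT.normal
  exact disjoint_iff.1 ((hT.le_or_disjoint inferInstance).resolve_left
    (hM.not_le_centralizer_self hT))

theorem sup_le_of_forall {T X : Subgroup M} (hT : T ≤ X)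
    (h : ∀ T', IsMinimalNormal T' → T' ≠ T → T' ≤ X) : X = ⊤ := by
  rw [eq_top_iff, ← hM.socle_eq_top]
  refine sSup_le fun T' hT' => ?_
  by_cases hTT : T' = T
  · exact hTT ▸ hT
  · exact h T' hT' hTT

theorem sup_centralizer {T : Subgroup M} (hT : IsMinimalNormal T) :
    T ⊔ Subgroup.centralizer (T : Set M) = ⊤ :=
  hM.sup_le_of_forall le_sup_left fun _ hT' h => (hT'.le_centralizer hT h).trans le_sup_right

theorem eq_of_le_centralizer_iff {T T' : Subgroup M} (hT : IsMinimalNormal T)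
    (hT' : IsMinimalNormal T') : T ≤ Subgroup.centralizer (T' : Set M) ↔ T ≠ T' := by
  refine ⟨?_, hT.le_centralizer hT'⟩
  rintro h rfl
  exact hM.not_le_centralizer_self hT h

theorem centralizer_injOn {T T' : Subgroup M} (hT : IsMinimalNormal T)
    (hT' : IsMinimalNormal T')
    (h : Subgroup.centralizer (T : Set M) = Subgroup.centralizer (T' : Set M)) : T = T' := by
  by_contra hne
  have := (hM.eq_of_le_centralizer_iff hT hT').2 hne
  rw [← h] at this
  exact hM.not_le_centralizer_self hT this

theorem le_iff_not_le_centralizer {T K : Subgroup M} (hT : IsMinimalNormal T)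
    (hK : K.Normal) : T ≤ K ↔ ¬ K ≤ Subgroup.centralizer (T : Set M) := by
  constructor
  · intro h h'
    exact hM.not_le_centralizer_self hT (h.trans h')
  · intro h
    refine (hT.le_or_le_centralizer hK).resolve_right fun h' => h ?_
    exact Subgroup.le_centralizer_iff.1 h'

theorem isDirectDecomposition : IsDirectDecomposition {T : Subgroup M | IsMinimalNormal T} where
  normal _ hT := hT.normal
  ne_bot _ hT := hT.ne_bot
  sSup_eq_top := hM.socle_eq_top
  indep T hT := by
    rw [disjoint_iff, eq_bot_iff, ← hM.inf_centralizer hT]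
    exact inf_le_inf_left _ (IsMinimalNormal.sSup_le_centralizer hT)

/-- A minimal normal subgroup inside no factor of another decomposition would centralise all its
factors, hence itself. -/
theorem isFinestDirectDecomposition :
    IsFinestDirectDecomposition {T : Subgroup M | IsMinimalNormal T} := by
  refine ⟨hM.isDirectDecomposition, fun D' hD' T hT => ?_⟩
  by_contra! h
  refine hM.not_le_centralizer_self hT ?_
  have h1 : (⊤ : Subgroup M) ≤ Subgroup.centralizer (T : Set M) := by
    rw [← hD'.sSup_eq_top]
    refine sSup_le fun K hK => ?_
    exact Subgroup.le_centralizer_iff.1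
      ((IsMinimalNormal.le_or_le_centralizer hT (hD'.normal K hK)).resolve_left (h K hK))
  exact le_top.trans h1

/-- Any finest decomposition consists of all minimal normal subgroups, and the product of those
other than `T` acts as `C(T)`. Projection to `T` thus becomes reduction modulo `C(T)`, the form used
from here on. -/
theorem isSubdirect_iff {H : Subgroup M} : IsSubdirect H ↔
    ∀ T : Subgroup M, IsMinimalNormal T → H ⊔ Subgroup.centralizer (T : Set M) = ⊤ := by
  constructor
  · rintro ⟨D, hD, h⟩ T hT
    have hsub : ∀ K ∈ D, IsMinimalNormal K := by
      intro K hK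
      obtain ⟨T', hT', hle⟩ := hD.2 _ hM.isDirectDecomposition K hK
      rw [IsMinimalNormal.eq_of_le hT' (hD.1.normal K hK) (hD.1.ne_bot K hK) hle]
      exact hT'
    have hTD : T ∈ D := by
      by_contra hTD
      refine hM.not_le_centralizer_self hT ?_
      have h1 : (⊤ : Subgroup M) ≤ Subgroup.centralizer (T : Set M) := by
        rw [← hD.1.sSup_eq_top]
        exact sSup_le fun K hK => (hsub K hK).le_centralizer hT fun h => hTD (h ▸ hK)
      exact le_top.trans h1
    rw [eq_top_iff, ← hM.sup_centralizer hT]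
    refine sup_le (fun x hx => ?_) le_sup_right
    obtain ⟨y, hy, c, hc, rfl⟩ := h T hTD x hx
    have h2 : sSup (D \ {T}) ≤ Subgroup.centralizer (T : Set M) :=
      sSup_le fun K hK => (hsub K hK.1).le_centralizer hT hK.2
    have h3 := mul_mem (Subgroup.mem_sup_left (T := Subgroup.centralizer (T : Set M)) hy)
      (Subgroup.mem_sup_right (S := H) (inv_mem (h2 hc)))
    simpa using h3
  · intro h
    refine ⟨_, hM.isFinestDirectDecomposition, fun T hT x hx => ?_⟩
    have := IsMinimalNormal.normal hT
    have h1 : x ∈ H ⊔ Subgroup.centralizer (T : Set M) := by rw [h T hT]; trivial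
    obtain ⟨y, hy, c, hc, rfl⟩ := Subgroup.mem_sup_of_normal_right.1 h1
    refine ⟨y, hy, c⁻¹, ?_, by simp⟩
    have h2 : c ∈ T ⊔ sSup ({T | IsMinimalNormal T} \ {T}) := by
      have : T ⊔ sSup ({T | IsMinimalNormal T} \ {T}) = ⊤ :=
        hM.sup_le_of_forall le_sup_left fun T' hT' hne =>
          (le_sSup (show T' ∈ {T | IsMinimalNormal T} \ {T} from ⟨hT', hne⟩)).trans le_sup_right
      rw [this]; trivial
    obtain ⟨t, ht, z, hz, rfl⟩ := Subgroup.mem_sup_of_normal_left.1 h2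
    have h3 : t ∈ T ⊓ Subgroup.centralizer (T : Set M) := by
      refine ⟨ht, ?_⟩
      have := mul_mem hc (inv_mem (IsMinimalNormal.sSup_le_centralizer hT hz))
      simpa using this
    rw [hM.inf_centralizer hT, Subgroup.mem_bot] at h3
    subst h3
    simpa using hz

end IsCenterlessSocle

theorem socle_characteristic : (socle M).Characteristic := by
  rw [Subgroup.characteristic_iff_map_le]
  intro φ
  rw [Subgroup.map_le_iff_le_comap]
  refine sSup_le fun T hT => ?_
  rw [← Subgroup.map_le_iff_le_comap]
  exact le_sSup (hT.map_mulEquiv φ)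

section

variable {G : Type*} [Group G] {N : Subgroup G}

theorem IsMinimalNormal.characteristic_eq_top (hN : IsMinimalNormal N) {K : Subgroup N}
    (hK : K.Characteristic) (hK' : K ≠ ⊥) : K = ⊤ := by
  have := hN.normal
  have h := hN.eq_of_le (K := K.map N.subtype) inferInstance
    (fun h => hK' ((Subgroup.map_eq_bot_iff_of_injective _ N.subtype_injective).1 h))
    (Subgroup.map_subtype_le K)
  exact Subgroup.map_injective N.subtype_injective
    (h.trans (N.range_subtype.symm.trans N.subtype.range_eq_map))

/-- The centre and the socle are characteristic in `N`, and a minimal normal subgroup is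
characteristically simple. -/
theorem IsMinimalNormal.isCenterlessSocle [Finite G] (hN : IsMinimalNormal N)
    (hcomm : ¬ IsMulCommutative N) : IsCenterlessSocle N := by
  have hcenter : Subgroup.center N = ⊥ := by
    by_contra h
    have h1 := hN.characteristic_eq_top inferInstance h
    refine hcomm ⟨⟨fun a b => ?_⟩⟩
    have ha : a ∈ Subgroup.center N := h1 ▸ trivial
    exact (Subgroup.mem_center_iff.1 ha b).symm
  refine ⟨hcenter, hN.characteristic_eq_top socle_characteristic ?_⟩
  have hbot : (⊤ : Subgroup N) ≠ ⊥ := by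
    intro h
    exact hN.ne_bot ((Subgroup.eq_bot_iff_forall _).2 fun x hx => by
      have : (⟨x, hx⟩ : N) ∈ (⊥ : Subgroup N) := h ▸ trivial
      exact congrArg Subtype.val (Subgroup.mem_bot.1 this))
  obtain ⟨T, hT, -⟩ := exists_isMinimalNormal_le (M := N) inferInstance hbot
  exact fun h => hT.ne_bot (le_bot_iff.1 (h ▸ le_sSup hT))

/-- If no conjugate of `T` were `T'`, all of them would centralise `T'`; but they generate a normal
subgroup of `G`, which is `N` by minimality, so `T'` would centralise itself. -/
theorem IsMinimalNormal.exists_conj [N.Normal] (hN : IsMinimalNormal N)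
    (hS : IsCenterlessSocle N) {T T' : Subgroup N} (hT : IsMinimalNormal T)
    (hT' : IsMinimalNormal T') :
    ∃ g : G, T.map (MulAut.conjNormal g : MulAut N).toMonoidHom = T' := by
  by_contra! h
  let X := Subgroup.normalClosure ((T.map N.subtype : Subgroup G) : Set G)
  have hTX : T.map N.subtype ≤ X := Subgroup.le_normalClosure
  have hX : X = N := by
    refine hN.eq_of_le inferInstance (fun hX => hT.ne_bot ?_)
      (Subgroup.normalClosure_le_normal (Subgroup.map_subtype_le T))
    rw [hX, le_bot_iff] at hTX
    exact (Subgroup.map_eq_bot_iff_of_injective _ N.subtype_injective).1 hTX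
  have h1 : X ≤ (Subgroup.centralizer (T' : Set N)).map N.subtype := by
    refine (Subgroup.closure_le _).2 fun x hx => ?_
    obtain ⟨y, hy, hxy⟩ := Group.mem_conjugatesOfSet_iff.1 hx
    obtain ⟨t, ht, rfl⟩ := hy
    obtain ⟨g, rfl⟩ := isConj_iff.1 hxy
    have h2 := (hT.map_mulEquiv (MulAut.conjNormal g : MulAut N)).le_centralizer hT' (h g)
    exact ⟨_, h2 ⟨t, ht, rfl⟩, by simp [MulAut.conjNormal_apply]⟩
  refine hS.not_le_centralizer_self hT' fun t _ => ?_
  have ht : (t : G) ∈ X := by rw [hX]; exact t.2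
  obtain ⟨s, hs, hst⟩ := h1 ht
  rwa [← N.subtype_injective hst]

end

end MinimalNormal

/-! ### Subdirect subgroups: order, contained factors, normalisers -/

section Subdirect

variable {M : Type*} [Group M]

/-- The kernels of the projections of `K` to the minimal normal subgroups of the ambient group
along their centralisers. -/
def projKernels (K : Subgroup M) : Set (Subgroup M) :=
  (fun T : Subgroup M => K ⊓ Subgroup.centralizer (T : Set M)) '' {T | IsMinimalNormal T}

/-- `K` projects onto every minimal normal subgroup of the ambient group. -/
def IsFullProj (K : Subgroup M) : Prop :=
  ∀ T : Subgroup M, IsMinimalNormal T → K ⊔ Subgroup.centralizer (T : Set M) = ⊤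

theorem IsFullProj.mono {K L : Subgroup M} (hK : IsFullProj K) (h : K ≤ L) : IsFullProj L :=
  fun T hT => top_le_iff.1 ((hK T hT).symm.le.trans (sup_le_sup_right h _))

theorem IsFullProj.top : IsFullProj (⊤ : Subgroup M) := fun _ _ => top_sup_eq _

theorem normal_sup_of_forall_conj_mem {K A C : Subgroup M} [C.Normal] (hKC : K ⊔ C = ⊤)
    (hA : ∀ k ∈ K, ∀ a ∈ A, k * a * k⁻¹ ∈ A) : (A ⊔ C).Normal := by
  refine ⟨fun n hn g => ?_⟩
  obtain ⟨a, ha, c, hc, rfl⟩ := Subgroup.mem_sup_of_normal_right.1 hn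
  have hg : g ∈ K ⊔ C := by rw [hKC]; trivial
  obtain ⟨k, hk, d, hd, rfl⟩ := Subgroup.mem_sup_of_normal_right.1 hg
  refine Subgroup.mem_sup_of_normal_right.2
    ⟨k * a * k⁻¹, hA k hk a ha, k * (a⁻¹ * d * a * c * d⁻¹) * k⁻¹, ?_, by group⟩
  refine Subgroup.Normal.conj_mem inferInstance _ (mul_mem (mul_mem ?_ hc) (inv_mem hd)) k
  simpa using Subgroup.Normal.conj_mem inferInstance d hd a⁻¹

theorem inf_centralizer_conj_mem {K T : Subgroup M} [T.Normal] {k a : M} (hk : k ∈ K)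
    (ha : a ∈ K ⊓ Subgroup.centralizer (T : Set M)) :
    k * a * k⁻¹ ∈ K ⊓ Subgroup.centralizer (T : Set M) :=
  Subgroup.mem_inf.2
    ⟨mul_mem (mul_mem hk ha.1) (inv_mem hk), Subgroup.Normal.conj_mem inferInstance a ha.2 k⟩

theorem relIndex_centralizer {A T : Subgroup M} (hT : IsMinimalNormal T)
    (hA : A ⊔ Subgroup.centralizer (T : Set M) = ⊤) :
    (Subgroup.centralizer (T : Set M)).relIndex A = (Subgroup.centralizer (T : Set M)).index := by
  have := hT.normal
  rw [← Subgroup.relIndex_sup_right, hA, Subgroup.relIndex_top_right]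

namespace IsCenterlessSocle

variable (hM : IsCenterlessSocle M)

include hM

/-- As `K` covers `M` modulo `C(T)`, a `K`-invariant `A` becomes normal after multiplying by `C(T)`.
Being outside `C(T)`, the product contains `T`, and `T` and `C(T)` generate `M`. -/
theorem sup_eq_top_of_not_le {T A K : Subgroup M} (hT : IsMinimalNormal T)
    (hKC : K ⊔ Subgroup.centralizer (T : Set M) = ⊤) (hA : ∀ k ∈ K, ∀ a ∈ A, k * a * k⁻¹ ∈ A)
    (hle : ¬ A ≤ Subgroup.centralizer (T : Set M)) :
    A ⊔ Subgroup.centralizer (T : Set M) = ⊤ := by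
  have := hT.normal
  have hX := normal_sup_of_forall_conj_mem hKC hA
  have hTX : T ≤ A ⊔ Subgroup.centralizer (T : Set M) :=
    (hM.le_iff_not_le_centralizer hT hX).2 fun h => hle (le_sup_left.trans h)
  rw [eq_top_iff, ← hM.sup_centralizer hT]
  exact sup_le hTX le_sup_right

/-- The intersection contains the commutators of `A` with `B`. If it were inside `C(T)`, then `M`
would be abelian modulo `C(T)`, forcing `T` to be abelian. -/
theorem inf_sup_eq_top {T A B K : Subgroup M} (hT : IsMinimalNormal T)
    (hKC : K ⊔ Subgroup.centralizer (T : Set M) = ⊤) (hAK : A ≤ K) (hBK : B ≤ K)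
    (hA : ∀ k ∈ K, ∀ a ∈ A, k * a * k⁻¹ ∈ A) (hB : ∀ k ∈ K, ∀ a ∈ B, k * a * k⁻¹ ∈ B)
    (hAC : A ⊔ Subgroup.centralizer (T : Set M) = ⊤)
    (hBC : B ⊔ Subgroup.centralizer (T : Set M) = ⊤) :
    A ⊓ B ⊔ Subgroup.centralizer (T : Set M) = ⊤ := by
  have := hT.normal
  refine hM.sup_eq_top_of_not_le hT hKC
    (fun k hk a ha => ⟨hA k hk a ha.1, hB k hk a ha.2⟩) fun hle => ?_
  refine hM.not_le_centralizer_self hT fun x hx => Subgroup.mem_centralizer_iff.2 fun y hy => ?_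
  have h1 : x * y * x⁻¹ * y⁻¹ ∈ T ⊓ Subgroup.centralizer (T : Set M) := by
    refine Subgroup.mem_inf.2 ⟨mul_mem (mul_mem (mul_mem hx hy) (inv_mem hx)) (inv_mem hy), ?_⟩
    obtain ⟨a, ha, c, hc, rfl⟩ := Subgroup.mem_sup_of_normal_right.1
      (show x ∈ A ⊔ Subgroup.centralizer (T : Set M) by rw [hAC]; trivial)
    obtain ⟨b, hb, d, hd, rfl⟩ := Subgroup.mem_sup_of_normal_right.1
      (show y ∈ B ⊔ Subgroup.centralizer (T : Set M) by rw [hBC]; trivial)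
    have hab : a * b * a⁻¹ * b⁻¹ ∈ A ⊓ B := by
      refine Subgroup.mem_inf.2 ⟨?_, mul_mem (hB a (hAK ha) b hb) (inv_mem hb)⟩
      have := mul_mem ha (hA b (hBK hb) _ (inv_mem ha))
      simpa only [mul_assoc] using this
    have h2 := hle hab
    rw [← QuotientGroup.eq_one_iff] at h2 hc hd ⊢
    simpa only [QuotientGroup.mk_mul, QuotientGroup.mk_inv, hc, hd, mul_one] using h2
  rw [hM.inf_centralizer hT, Subgroup.mem_bot, mul_inv_eq_one, mul_inv_eq_iff_eq_mul] at h1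
  exact h1.symm

theorem ncard_projKernels_top :
    (projKernels (⊤ : Subgroup M)).ncard = {T : Subgroup M | IsMinimalNormal T}.ncard := by
  refine Set.InjOn.ncard_image fun T hT T' hT' h => ?_
  exact hM.centralizer_injOn hT hT' (by simpa using h)

theorem inf_eq_bot_of_not_isolated {K T T' : Subgroup M} (hT : IsMinimalNormal T)
    (hT' : IsMinimalNormal T') (hne : T' ≠ T) (h : K ⊓ Subgroup.centralizer (T' : Set M) =
      K ⊓ Subgroup.centralizer (T : Set M)) : K ⊓ T = ⊥ := by
  rw [eq_bot_iff, ← hM.inf_centralizer hT]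
  intro x hx
  have h1 : x ∈ K ⊓ Subgroup.centralizer (T' : Set M) :=
    ⟨hx.1, hT.le_centralizer hT' hne.symm hx.2⟩
  rw [h] at h1
  exact ⟨hx.2, h1.2⟩

variable [Finite M] {t : ℕ}
  (ht : ∀ T : Subgroup M, IsMinimalNormal T → (Subgroup.centralizer (T : Set M)).index = t)

include ht

/-- All projection kernels have the same index `t` in `K`, so an inclusion between two of them is an
equality; distinct kernels are therefore not contained in one another. -/
theorem inf_centralizer_sup_eq_top {K T T' : Subgroup M} (hK : IsFullProj K)
    (hT : IsMinimalNormal T) (hT' : IsMinimalNormal T')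
    (hne : K ⊓ Subgroup.centralizer (T' : Set M) ≠ K ⊓ Subgroup.centralizer (T : Set M)) :
    K ⊓ Subgroup.centralizer (T' : Set M) ⊔ Subgroup.centralizer (T : Set M) = ⊤ := by
  have := hT'.normal
  refine hM.sup_eq_top_of_not_le hT (hK T hT) (fun k hk a ha => inf_centralizer_conj_mem hk ha)
    fun hle => hne (le_antisymm (le_inf inf_le_left hle) ?_)
  have h1 := Subgroup.relIndex_mul_relIndex (K ⊓ Subgroup.centralizer (T' : Set M))
    (K ⊓ Subgroup.centralizer (T : Set M)) K (le_inf inf_le_left hle) inf_le_left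
  rw [Subgroup.inf_relIndex_left K, Subgroup.inf_relIndex_left K,
    relIndex_centralizer hT (hK T hT), relIndex_centralizer hT' (hK T' hT'), ht T hT,
    ht T' hT'] at h1
  have htpos : 0 < t := by
    rw [← ht T hT]
    exact Nat.pos_of_ne_zero Subgroup.index_ne_zero_of_finite
  exact Subgroup.relIndex_eq_one.1 (Nat.eq_of_mul_eq_mul_right htpos (by rw [h1, one_mul]))

/-- Distinct kernels are independent, as in the Chinese remainder theorem: intersecting any number
of others leaves the projection to `T` onto. The invariance under `K` is carried along for the
induction. -/
theorem inf_finsetInf_sup_eq_top {K T : Subgroup M} (hK : IsFullProj K)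
    (hT : IsMinimalNormal T) (F : Finset (Subgroup M)) (hF : ∀ A ∈ F, A ∈ projKernels K)
    (hTF : K ⊓ Subgroup.centralizer (T : Set M) ∉ F) :
    (∀ k ∈ K, ∀ a ∈ K ⊓ F.inf id, k * a * k⁻¹ ∈ K ⊓ F.inf id) ∧
      K ⊓ F.inf id ⊔ Subgroup.centralizer (T : Set M) = ⊤ := by
  classical
  induction F using Finset.induction_on with
  | empty =>
    simp only [Finset.inf_empty, inf_top_eq]
    exact ⟨fun k hk a ha => mul_mem (mul_mem hk ha) (inv_mem hk), hK T hT⟩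
  | insert A F hAF ih =>
    obtain ⟨ih1, ih2⟩ := ih (fun B hB => hF B (Finset.mem_insert_of_mem hB))
      (fun h => hTF (Finset.mem_insert_of_mem h))
    obtain ⟨T', hT', rfl⟩ := hF A (Finset.mem_insert_self _ _)
    have hT'n := IsMinimalNormal.normal hT'
    have hconj : ∀ k ∈ K, ∀ a ∈ K ⊓ Subgroup.centralizer (T' : Set M),
        k * a * k⁻¹ ∈ K ⊓ Subgroup.centralizer (T' : Set M) :=
      fun k hk a ha => inf_centralizer_conj_mem hk ha
    have heq : K ⊓ (insert (K ⊓ Subgroup.centralizer (T' : Set M)) F).inf id =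
        (K ⊓ Subgroup.centralizer (T' : Set M)) ⊓ (K ⊓ F.inf id) := by
      rw [Finset.inf_insert, id, inf_inf_inf_comm, inf_idem, ← inf_assoc, ← inf_assoc, inf_idem,
        inf_assoc]
    simp only [heq]
    refine ⟨fun k hk a ha => ⟨hconj k hk a ha.1, ih1 k hk a ha.2⟩, ?_⟩
    refine hM.inf_sup_eq_top hT (hK T hT) inf_le_left inf_le_left hconj ih1
      (hM.inf_centralizer_sup_eq_top ht hK hT hT' fun h => hTF ?_) ih2
    exact h ▸ Finset.mem_insert_self _ _

theorem relIndex_inf_finsetInf {K : Subgroup M} (hK : IsFullProj K) (F : Finset (Subgroup M))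
    (hF : ∀ A ∈ F, A ∈ projKernels K) : (K ⊓ F.inf id).relIndex K = t ^ F.card := by
  classical
  induction F using Finset.induction_on with
  | empty => simp
  | insert A F hAF ih =>
    have hF' : ∀ A ∈ F, A ∈ projKernels K := fun B hB => hF B (Finset.mem_insert_of_mem hB)
    obtain ⟨T, hT, rfl⟩ := hF A (Finset.mem_insert_self _ _)
    have heq : K ⊓ (insert (K ⊓ Subgroup.centralizer (T : Set M)) F).inf id =
        (K ⊓ F.inf id) ⊓ Subgroup.centralizer (T : Set M) := by
      rw [Finset.inf_insert, id, ← inf_assoc, ← inf_assoc, inf_idem, inf_right_comm]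
    rw [Finset.card_insert_of_notMem hAF, pow_succ', ← ih hF', heq,
      ← Subgroup.relIndex_mul_relIndex _ (K ⊓ F.inf id) K inf_le_left inf_le_left,
      Subgroup.inf_relIndex_left,
      relIndex_centralizer hT (hM.inf_finsetInf_sup_eq_top ht hK hT F hF' hAF).2, ht T hT]

/-- Each distinct kernel contributes a factor `t` to the index of the intersection, and the
intersection of all of them is trivial. -/
theorem card_eq_pow {K : Subgroup M} (hK : IsFullProj K) :
    Nat.card K = t ^ (projKernels K).ncard := by
  classical
  have hfin : (projKernels K).Finite := Set.toFinite _
  have h := hM.relIndex_inf_finsetInf ht hK hfin.toFinset fun A hA => hfin.mem_toFinset.1 hA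
  rw [Set.ncard_eq_toFinset_card _ hfin, ← h]
  have hbot : K ⊓ hfin.toFinset.inf id = ⊥ := by
    refine (Subgroup.eq_bot_iff_forall _).2 fun x hx =>
      hM.eq_one_of_forall_commute fun T hT => ?_
    have h1 : hfin.toFinset.inf id ≤ K ⊓ Subgroup.centralizer (T : Set M) :=
      Finset.inf_le (f := id) (hfin.mem_toFinset.2 ⟨T, hT, rfl⟩)
    exact (h1 hx.2).2
  rw [hbot, Subgroup.relIndex_bot_left]

/-- The intersection of the other kernels centralises every other factor, so it lies in `T`. It
still projects onto `T` by independence, so it is non-trivial and normal in `M`; minimality makes it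
`T`. -/
theorem le_of_isolated {K T : Subgroup M} (hK : IsFullProj K) (hT : IsMinimalNormal T)
    (h : ∀ T' : Subgroup M, IsMinimalNormal T' → K ⊓ Subgroup.centralizer (T' : Set M) =
      K ⊓ Subgroup.centralizer (T : Set M) → T' = T) : T ≤ K := by
  classical
  have hTn := hT.normal
  have hfin : (projKernels K \ {K ⊓ Subgroup.centralizer (T : Set M)}).Finite := Set.toFinite _
  obtain ⟨h1, h2⟩ := hM.inf_finsetInf_sup_eq_top ht hK hT hfin.toFinset
    (fun A hA => (hfin.mem_toFinset.1 hA).1) (fun h => (hfin.mem_toFinset.1 h).2 rfl)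
  have h3 : K ⊓ hfin.toFinset.inf id ≤ T := by
    intro x hx
    obtain ⟨a, ha, c, hc, rfl⟩ := Subgroup.mem_sup_of_normal_left.1
      (show x ∈ T ⊔ Subgroup.centralizer (T : Set M) by rw [hM.sup_centralizer hT]; trivial)
    have : c = 1 := by
      refine hM.eq_one_of_forall_commute fun T' hT' => ?_
      by_cases hTT : T' = T
      · rwa [hTT]
      · have hle : hfin.toFinset.inf id ≤ K ⊓ Subgroup.centralizer (T' : Set M) :=
          Finset.inf_le (f := id) (hfin.mem_toFinset.2
            ⟨⟨T', hT', rfl⟩, fun heq => hTT (h T' hT' heq)⟩)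
        have h4 := mul_mem (inv_mem (hT.le_centralizer hT' (Ne.symm hTT) ha)) (hle hx.2).2
        simpa using h4
    subst this
    simpa using ha
  have h5 : (K ⊓ hfin.toFinset.inf id).Normal := by
    refine ⟨fun n hn g => ?_⟩
    obtain ⟨k, hk, c, hc, rfl⟩ := Subgroup.mem_sup_of_normal_right.1
      (show g ∈ K ⊔ Subgroup.centralizer (T : Set M) by rw [hK T hT]; trivial)
    have hcn := Subgroup.mem_centralizer_iff.1 hc n (h3 hn)
    have : k * c * n * (k * c)⁻¹ = k * n * k⁻¹ := by
      rw [mul_assoc k, ← hcn]; group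
    rw [this]
    exact h1 k hk n hn
  have h6 : K ⊓ hfin.toFinset.inf id ≠ ⊥ := by
    intro h7
    rw [h7, bot_sup_eq] at h2
    exact hM.not_le_centralizer_self hT (h2 ▸ le_top)
  rw [← hT.eq_of_le h5 h6 h3]
  exact inf_le_left

theorem le_iff_isolated {K T : Subgroup M} (hK : IsFullProj K) (hT : IsMinimalNormal T) :
    T ≤ K ↔ ∀ T' : Subgroup M, IsMinimalNormal T' → K ⊓ Subgroup.centralizer (T' : Set M) =
      K ⊓ Subgroup.centralizer (T : Set M) → T' = T := by
  refine ⟨fun h T' hT' heq => ?_, hM.le_of_isolated ht hK hT⟩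
  by_contra hne
  have := hM.inf_eq_bot_of_not_isolated hT hT' hne heq
  rw [inf_eq_right.2 h] at this
  exact hT.ne_bot this

/-- Factors inside `K` give at most one kernel each, while each kernel coming from a factor outside
`K` is shared by at least two such factors. -/
theorem two_mul_ncard_projKernels_add {K : Subgroup M} (hK : IsFullProj K) :
    2 * (projKernels K).ncard + {T : Subgroup M | IsMinimalNormal T ∧ ¬ T ≤ K}.ncard ≤
      2 * {T : Subgroup M | IsMinimalNormal T}.ncard := by
  classical
  have := Fintype.ofFinite (Subgroup M)
  let A := Finset.univ.filter fun T : Subgroup M => IsMinimalNormal T ∧ T ≤ K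
  let B := Finset.univ.filter fun T : Subgroup M => IsMinimalNormal T ∧ ¬ T ≤ K
  let f := fun T : Subgroup M => K ⊓ Subgroup.centralizer (T : Set M)
  have hB : {T : Subgroup M | IsMinimalNormal T ∧ ¬ T ≤ K}.ncard = B.card := by
    rw [← Set.ncard_coe_finset]; congr 1; ext T; simp [B]
  have hAB : {T : Subgroup M | IsMinimalNormal T}.ncard = A.card + B.card := by
    rw [← Finset.card_union_of_disjoint, ← Set.ncard_coe_finset]
    · congr 1; ext T; simp [A, B]; tauto
    · exact Finset.disjoint_left.2 fun T hA hB => (Finset.mem_filter.1 hB).2.2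
        (Finset.mem_filter.1 hA).2.2
  have hker : (projKernels K).ncard ≤ A.card + (B.image f).card := by
    have h1 : projKernels K = ((A.image f ∪ B.image f : Finset (Subgroup M)) : Set (Subgroup M)) := by
      rw [← Finset.image_union]
      ext X
      simp only [projKernels, Set.mem_image, Set.mem_ofPred_eq, Finset.coe_image, Finset.coe_union, A, B,
        Finset.coe_filter, Finset.mem_univ, true_and, Set.mem_union, f]
      constructor
      · rintro ⟨T, hT, rfl⟩
        exact ⟨T, by tauto, rfl⟩
      · rintro ⟨T, hT, rfl⟩
        exact ⟨T, by tauto, rfl⟩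
    rw [h1, Set.ncard_coe_finset]
    exact (Finset.card_union_le _ _).trans (Nat.add_le_add_right Finset.card_image_le _)
  have himg : 2 * (B.image f).card ≤ B.card := by
    refine Finset.mul_card_image_le_card_of_maps_to (f := f)
      (fun T hT => Finset.mem_image_of_mem f hT) 2 fun X hX => ?_
    obtain ⟨T, hT, rfl⟩ := Finset.mem_image.1 hX
    have hT' := (Finset.mem_filter.1 hT).2
    have h2 := hT'.2
    rw [hM.le_iff_isolated ht hK hT'.1] at h2
    push Not at h2
    obtain ⟨S, hS, heq, hne⟩ := h2
    refine Finset.one_lt_card.2 ⟨T, Finset.mem_filter.2 ⟨hT, rfl⟩, S,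
      Finset.mem_filter.2 ⟨Finset.mem_filter.2 ⟨Finset.mem_univ _, hS, ?_⟩, heq⟩, hne.symm⟩
    intro hle
    have := hM.inf_eq_bot_of_not_isolated hS hT'.1 hne.symm heq.symm
    rw [inf_eq_right.2 hle] at this
    exact hS.ne_bot this
  omega

/-- Subdirect subgroups are self-normalising. Factors with the same kernel in `K` have the same
kernel in the normaliser, so the normaliser has no more kernels than `K`, hence no larger order. -/
theorem mem_of_forall_conj_mem {K : Subgroup M} (hK : IsFullProj K) {m : M}
    (hm : ∀ x, x ∈ K ↔ m * x * m⁻¹ ∈ K) : m ∈ K := by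
  have hN := hK.mono (Subgroup.le_normalizer (H := K))
  have hcentral : ∀ T T' : Subgroup M, IsMinimalNormal T → IsMinimalNormal T' →
      K ⊓ Subgroup.centralizer (T : Set M) = K ⊓ Subgroup.centralizer (T' : Set M) →
      Subgroup.normalizer (K : Set M) ⊓ Subgroup.centralizer (T : Set M) ≤
        Subgroup.normalizer (K : Set M) ⊓ Subgroup.centralizer (T' : Set M) := by
    intro T T' hT hT' h n hn
    refine ⟨hn.1, ?_⟩
    have := hT.normal
    have := hT'.normal
    -- Commutators of `n` with `K` lie in the kernel common to `T` and `T'`. Since `K` covers `M`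
    -- modulo `C(T')`, this makes `n` central modulo `C(T')`, so `n` centralises `T'`.
    have key : ∀ x ∈ K, n * x * n⁻¹ * x⁻¹ ∈ Subgroup.centralizer (T' : Set M) := by
      intro x hx
      have h1 : n * x * n⁻¹ * x⁻¹ ∈ K ⊓ Subgroup.centralizer (T : Set M) := by
        refine Subgroup.mem_inf.2 ⟨mul_mem ((Subgroup.mem_normalizer_iff.1 hn.1 x).1 hx) (inv_mem hx), ?_⟩
        have h2 := mul_mem (Subgroup.mem_inf.1 hn).2 (Subgroup.Normal.conj_mem
          (inferInstance : (Subgroup.centralizer (T : Set M)).Normal) _ (inv_mem hn.2) x)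
        simpa only [mul_assoc] using h2
      rw [h] at h1
      exact h1.2
    refine Subgroup.mem_centralizer_iff.2 fun y hy => ?_
    obtain ⟨x, hx, c, hc, rfl⟩ := Subgroup.mem_sup_of_normal_right.1
      (show y ∈ K ⊔ Subgroup.centralizer (T' : Set M) by rw [hK T' hT']; trivial)
    have h3 : n * (x * c) * n⁻¹ * (x * c)⁻¹ ∈ T' ⊓ Subgroup.centralizer (T' : Set M) := by
      refine Subgroup.mem_inf.2 ⟨mul_mem (Subgroup.Normal.conj_mem inferInstance _ hy n) (inv_mem hy), ?_⟩
      have h4 := key x hx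
      rw [← QuotientGroup.eq_one_iff] at h4 hc ⊢
      simpa only [QuotientGroup.mk_mul, QuotientGroup.mk_inv, hc, mul_one] using h4
    rw [hM.inf_centralizer hT', Subgroup.mem_bot, mul_inv_eq_one, mul_inv_eq_iff_eq_mul] at h3
    exact h3.symm
  have hle : (projKernels (Subgroup.normalizer (K : Set M))).ncard ≤ (projKernels K).ncard := by
    have hfin := Set.toFinite (projKernels K)
    -- A kernel of `K` determines the kernel of the normaliser; the supremum is over equal subgroups
    -- and merely avoids choosing a factor.
    have himg : projKernels (Subgroup.normalizer (K : Set M)) ⊆ (fun A : Subgroup M =>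
        sSup ((fun T : Subgroup M => Subgroup.normalizer (K : Set M) ⊓ Subgroup.centralizer (T : Set M)) ''
          {T | IsMinimalNormal T ∧ K ⊓ Subgroup.centralizer (T : Set M) = A})) '' projKernels K := by
      rintro _ ⟨T, hT, rfl⟩
      refine ⟨_, ⟨T, hT, rfl⟩, le_antisymm (sSup_le ?_) (le_sSup ⟨T, ⟨hT, rfl⟩, rfl⟩)⟩
      rintro _ ⟨T', ⟨hT', heq⟩, rfl⟩
      exact hcentral T' T hT' hT heq
    exact (Set.ncard_le_ncard himg (hfin.image _)).trans (Set.ncard_image_le hfin)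
  -- The value of `t` is unconstrained when there are no minimal normal subgroups, and only then can
  -- it be `0`; in that case `M` is trivial.
  by_cases htriv : t = 0
  · have hno : ∀ T : Subgroup M, ¬ IsMinimalNormal T := fun T hT =>
      Subgroup.index_ne_zero_of_finite ((ht T hT).trans htriv)
    rw [hM.eq_one_of_forall_commute (x := m) fun T hT => (hno T hT).elim]
    exact one_mem K
  · have hcard : Nat.card (Subgroup.normalizer (K : Set M)) ≤ Nat.card K := by
      rw [hM.card_eq_pow ht hN, hM.card_eq_pow ht hK]
      exact Nat.pow_le_pow_right (Nat.pos_of_ne_zero htriv) hle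
    rw [Subgroup.eq_of_le_of_card_ge Subgroup.le_normalizer hcard]
    exact Subgroup.mem_normalizer_iff.2 hm

end IsCenterlessSocle

end Subdirect

/-! ### Normal subgroups relative to a subgroup -/

section NormalIn

variable {X : Type*} [Group X]

/-- `N` is a normal subgroup of the subgroup `G`. -/
structure NormalIn (N G : Subgroup X) : Prop where
  le : N ≤ G
  conj_mem : ∀ g ∈ G, ∀ n ∈ N, g * n * g⁻¹ ∈ N

/-- `N` is a minimal normal subgroup of the subgroup `G`. -/
def MinNormalIn (N G : Subgroup X) : Prop :=
  Minimal (fun K : Subgroup X => NormalIn K G ∧ K ≠ ⊥) N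

theorem normalIn_of_subgroupOf_normal {N G : Subgroup X} (hle : N ≤ G)
    (h : (N.subgroupOf G).Normal) : NormalIn N G where
  le := hle
  conj_mem g hg n hn := h.conj_mem ⟨n, hle hn⟩ hn ⟨g, hg⟩

theorem NormalIn.subgroupOf_normal {N G : Subgroup X} (h : NormalIn N G) :
    (N.subgroupOf G).Normal :=
  ⟨fun n hn g => h.conj_mem g g.2 n hn⟩

theorem normalIn_map_subtype {G : Subgroup X} {N : Subgroup G} (h : N.Normal) :
    NormalIn (N.map G.subtype) G where
  le := Subgroup.map_subtype_le N
  conj_mem := by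
    rintro g hg _ ⟨n, hn, rfl⟩
    exact ⟨_, h.conj_mem n hn ⟨g, hg⟩, rfl⟩

theorem NormalIn.inf {N K G : Subgroup X} (hN : NormalIn N G) (hK : NormalIn K G) :
    NormalIn (N ⊓ K) G where
  le := inf_le_left.trans hN.le
  conj_mem g hg n hn := Subgroup.mem_inf.2
    ⟨hN.conj_mem g hg n hn.1, hK.conj_mem g hg n hn.2⟩

theorem NormalIn.centralizer {N G : Subgroup X} (hN : NormalIn N G) :
    NormalIn (G ⊓ Subgroup.centralizer (N : Set X)) G where
  le := inf_le_left
  conj_mem g hg c hc := by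
    refine Subgroup.mem_inf.2 ⟨mul_mem (mul_mem hg hc.1) (inv_mem hg),
      Subgroup.mem_centralizer_iff.2 fun n hn => ?_⟩
    have h1 := Subgroup.mem_centralizer_iff.1 (Subgroup.mem_inf.1 hc).2 _
      (hN.conj_mem _ (inv_mem hg) n hn)
    have h2 : n = g * (g⁻¹ * n * g⁻¹⁻¹) * g⁻¹ := by group
    rw [h2]
    calc g * (g⁻¹ * n * g⁻¹⁻¹) * g⁻¹ * (g * c * g⁻¹)
        = g * (g⁻¹ * n * g⁻¹⁻¹ * c) * g⁻¹ := by group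
      _ = g * (c * (g⁻¹ * n * g⁻¹⁻¹)) * g⁻¹ := by rw [h1]
      _ = _ := by group

theorem isMinimalNormal_iff {G : Subgroup X} {N : Subgroup G} :
    IsMinimalNormal N ↔ MinNormalIn (N.map G.subtype) G := by
  have hbot : ∀ K : Subgroup G, K.map G.subtype = ⊥ ↔ K = ⊥ := fun K =>
    Subgroup.map_eq_bot_iff_of_injective _ G.subtype_injective
  constructor
  · intro h
    refine ⟨⟨normalIn_map_subtype h.normal, (hbot N).not.2 h.ne_bot⟩, fun K hK hle => ?_⟩
    rw [← Subgroup.map_subgroupOf_eq_of_le hK.1.le] at hle ⊢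
    refine Subgroup.map_mono (h.2 ⟨hK.1.subgroupOf_normal, fun h' => hK.2 ?_⟩
      ((Subgroup.map_le_map_iff_of_injective G.subtype_injective).1 hle))
    rw [← Subgroup.map_subgroupOf_eq_of_le hK.1.le, h', Subgroup.map_bot]
  · intro h
    refine ⟨⟨?_, (hbot N).not.1 h.1.2⟩, fun K hK hle => ?_⟩
    · have := h.1.1.subgroupOf_normal
      rwa [← Subgroup.comap_subtype,
        Subgroup.comap_map_eq_self_of_injective G.subtype_injective] at this
    · exact (Subgroup.map_le_map_iff_of_injective G.subtype_injective).1
        (h.2 ⟨normalIn_map_subtype hK.1, (hbot K).not.2 hK.2⟩ (Subgroup.map_mono hle))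

namespace MinNormalIn

theorem isMinimalNormal_subgroupOf {N G : Subgroup X} (h : MinNormalIn N G) :
    IsMinimalNormal (N.subgroupOf G) := by
  rw [isMinimalNormal_iff, Subgroup.map_subgroupOf_eq_of_le h.1.1.le]
  exact h

theorem eq_of_le {N K G : Subgroup X} (h : MinNormalIn N G) (hK : NormalIn K G) (hK' : K ≠ ⊥)
    (hle : K ≤ N) : K = N :=
  le_antisymm hle (h.2 ⟨hK, hK'⟩ hle)

theorem le_or_inf_eq_bot {N K G : Subgroup X} (h : MinNormalIn N G) (hK : NormalIn K G) :
    N ≤ K ∨ N ⊓ K = ⊥ := by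
  by_cases h' : N ⊓ K = ⊥
  · exact Or.inr h'
  · left
    rw [← h.eq_of_le (h.1.1.inf hK) h' inf_le_left]
    exact inf_le_right

end MinNormalIn

theorem NormalIn.commutator_mem_inf {N K G : Subgroup X} (hN : NormalIn N G) (hK : NormalIn K G)
    {n k : X} (hn : n ∈ N) (hk : k ∈ K) : n * k * n⁻¹ * k⁻¹ ∈ N ⊓ K := by
  refine Subgroup.mem_inf.2 ⟨?_, mul_mem (hK.conj_mem n (hN.le hn) k hk) (inv_mem hk)⟩
  have := mul_mem hn (hN.conj_mem k (hK.le hk) _ (inv_mem hn))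
  simpa only [mul_assoc] using this

theorem NormalIn.le_centralizer_of_inf_eq_bot {N K G : Subgroup X} (hN : NormalIn N G)
    (hK : NormalIn K G) (h : N ⊓ K = ⊥) : N ≤ Subgroup.centralizer (K : Set X) := by
  intro n hn
  refine Subgroup.mem_centralizer_iff.2 fun k hk => ?_
  have h1 := hN.commutator_mem_inf hK hn hk
  rw [h, Subgroup.mem_bot, mul_inv_eq_one, mul_inv_eq_iff_eq_mul] at h1
  exact h1.symm

theorem exists_minNormalIn_le [Finite X] {K G : Subgroup X} (hK : NormalIn K G) (hK' : K ≠ ⊥) :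
    ∃ N, MinNormalIn N G ∧ N ≤ K := by
  obtain ⟨T, hTK, hT⟩ := (Set.toFinite {K : Subgroup X | NormalIn K G ∧ K ≠ ⊥}).exists_le_minimal
    (show K ∈ {K : Subgroup X | NormalIn K G ∧ K ≠ ⊥} from ⟨hK, hK'⟩)
  exact ⟨T, hT, hTK⟩

end NormalIn

/-! ### Socles, quasiprimitivity and centralisers for permutation groups -/

section Perm

variable {Ω : Type*}

instance finite_setoid [Finite Ω] : Finite (Setoid Ω) :=
  Finite.of_injective (fun r x y => r x y) fun _ _ h =>
    Setoid.ext fun x y => iff_of_eq (congrFun (congrFun h x) y)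

theorem permSocle_eq_sSup (G : Subgroup (Equiv.Perm Ω)) :
    permSocle G = sSup {N | MinNormalIn N G} := by
  rw [permSocle, socle]
  apply le_antisymm
  · rw [Subgroup.map_le_iff_le_comap]
    refine sSup_le fun N hN => ?_
    rw [← Subgroup.map_le_iff_le_comap]
    exact le_sSup (isMinimalNormal_iff.1 hN)
  · refine sSup_le fun N hN => ?_
    have hN' : MinNormalIn N G := hN
    rw [← Subgroup.map_subgroupOf_eq_of_le hN'.1.1.le]
    exact Subgroup.map_mono (le_sSup hN'.isMinimalNormal_subgroupOf)

theorem MinNormalIn.le_permSocle {N G : Subgroup (Equiv.Perm Ω)} (h : MinNormalIn N G) :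
    N ≤ permSocle G := by
  rw [permSocle_eq_sSup]
  exact le_sSup h

theorem permSocle_normalIn (G : Subgroup (Equiv.Perm Ω)) : NormalIn (permSocle G) G := by
  have : (socle G).Characteristic := socle_characteristic
  exact normalIn_map_subtype inferInstance

theorem isPretransitive_iff {N : Subgroup (Equiv.Perm Ω)} :
    MulAction.IsPretransitive N Ω ↔ ∀ x y : Ω, ∃ n ∈ N, n x = y := by
  constructor
  · intro h x y
    obtain ⟨n, hn⟩ := h.exists_smul_eq x y
    exact ⟨n, n.2, hn⟩
  · intro h
    refine ⟨fun x y => ?_⟩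
    obtain ⟨n, hn, hxy⟩ := h x y
    exact ⟨⟨n, hn⟩, hxy⟩

theorem isQuasiPreprimitive_iff {G : Subgroup (Equiv.Perm Ω)} :
    MulAction.IsQuasiPreprimitive G Ω ↔ MulAction.IsPretransitive G Ω ∧
      ∀ N, NormalIn N G → N ≠ ⊥ → MulAction.IsPretransitive N Ω := by
  constructor
  · intro h
    refine ⟨h.1, fun N hN hbot => ?_⟩
    have := hN.subgroupOf_normal
    have h1 : MulAction.IsPretransitive (N.subgroupOf G) Ω := by
      refine h.isPretransitive_of_normal fun hfix => hbot ?_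
      refine (Subgroup.eq_bot_iff_forall _).2 fun n hn => Equiv.ext fun x => ?_
      have hx : x ∈ MulAction.fixedPoints (N.subgroupOf G) Ω := hfix ▸ Set.mem_univ x
      exact hx ⟨⟨n, hN.le hn⟩, hn⟩
    rw [isPretransitive_iff]
    intro x y
    obtain ⟨n, hn⟩ := h1.exists_smul_eq x y
    exact ⟨n.1.1, n.2, hn⟩
  · rintro ⟨h1, h2⟩
    refine { toIsPretransitive := h1, isPretransitive_of_normal := fun {N} hN hfix => ?_ }
    have h3 : MulAction.IsPretransitive (N.map G.subtype) Ω := by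
      refine h2 _ (normalIn_map_subtype hN) fun hbot => hfix ?_
      rw [Subgroup.map_eq_bot_iff_of_injective _ G.subtype_injective] at hbot
      subst hbot
      refine Set.eq_univ_of_forall fun x n => ?_
      have : n.1 = 1 := Subgroup.mem_bot.1 n.2
      change (n.1 : Equiv.Perm Ω) x = x
      rw [this]
      rfl
    refine ⟨fun x y => ?_⟩
    obtain ⟨_, ⟨n, hn, rfl⟩, hxy⟩ := isPretransitive_iff.1 h3 x y
    exact ⟨⟨n, hn⟩, hxy⟩

theorem eq_one_of_mem_centralizer {A : Subgroup (Equiv.Perm Ω)}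
    (hA : MulAction.IsPretransitive A Ω) {c : Equiv.Perm Ω}
    (hc : c ∈ Subgroup.centralizer (A : Set (Equiv.Perm Ω))) {x : Ω} (hx : c x = x) : c = 1 := by
  ext y
  obtain ⟨a, ha, rfl⟩ := isPretransitive_iff.1 hA x y
  have := Equiv.congr_fun (Subgroup.mem_centralizer_iff.1 hc a ha) x
  simp only [Equiv.Perm.coe_mul, Function.comp_apply, hx] at this
  exact this.symm

/-- The centraliser of a transitive group is semiregular, so one of its elements equals the element
of `A` that agrees with it at one point. -/
theorem centralizer_le_of_isPretransitive [Nonempty Ω] {A : Subgroup (Equiv.Perm Ω)}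
    (hA : MulAction.IsPretransitive A Ω)
    (hcomm : A ≤ Subgroup.centralizer (A : Set (Equiv.Perm Ω))) :
    Subgroup.centralizer (A : Set (Equiv.Perm Ω)) ≤ A := by
  intro c hc
  obtain ⟨x⟩ := ‹Nonempty Ω›
  obtain ⟨a, ha, hx⟩ := isPretransitive_iff.1 hA x (c x)
  have h1 : a⁻¹ * c = 1 := eq_one_of_mem_centralizer hA (mul_mem (inv_mem (hcomm ha)) hc)
    (x := x) (by simp [← hx])
  rw [inv_mul_eq_one] at h1
  exact h1 ▸ ha

end Perm

/-! ### Permutations inducing permutations on the parts of a partition -/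

section Induces

variable {Ω : Type*}

/-- The permutation `g` induces the permutation `σ` on the set of parts of `r`. -/
def Induces (g : Equiv.Perm Ω) (r : Setoid Ω) (σ : Equiv.Perm (Quotient r)) : Prop :=
  ∀ x, σ (Quotient.mk r x) = Quotient.mk r (g x)

variable {r : Setoid Ω} {g h : Equiv.Perm Ω} {σ τ : Equiv.Perm (Quotient r)}

theorem Induces.mem (hg : Induces g r σ) : g ∈ partitionStabilizer r := by
  intro x y
  rw [← Quotient.eq, ← Quotient.eq, ← hg, ← hg, σ.injective.eq_iff]

theorem induces_partAction (g : partitionStabilizer r) : Induces g r (partAction r g) :=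
  fun _ => rfl

theorem Induces.unique (hg : Induces g r σ) (hg' : Induces g r τ) : σ = τ := by
  ext q
  induction q using Quotient.inductionOn with
  | h x => rw [hg, hg']

theorem induces_one : Induces 1 r 1 := fun _ => rfl

theorem Induces.mul (hg : Induces g r σ) (hh : Induces h r τ) : Induces (g * h) r (σ * τ) :=
  fun x => by rw [Equiv.Perm.mul_apply, hh, hg, Equiv.Perm.mul_apply]

theorem Induces.inv (hg : Induces g r σ) : Induces g⁻¹ r σ⁻¹ := fun x => by
  rw [Equiv.Perm.inv_eq_iff_eq, hg, ← Equiv.Perm.mul_apply, mul_inv_cancel, Equiv.Perm.one_apply]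

theorem mem_component {G : Subgroup (Equiv.Perm Ω)} :
    σ ∈ component G r ↔ ∃ g ∈ G, Induces g r σ := by
  constructor
  · rintro ⟨g, hg, rfl⟩
    exact ⟨g, hg, induces_partAction g⟩
  · rintro ⟨g, hg, h⟩
    exact ⟨⟨g, h.mem⟩, hg, (induces_partAction _).unique h⟩

theorem mem_directProduct {E : Set (Setoid Ω)}
    {L : ∀ r : Setoid Ω, Subgroup (Equiv.Perm (Quotient r))} :
    g ∈ directProduct E L ↔ ∀ r ∈ E, ∃ σ ∈ L r, Induces g r σ := by
  simp only [directProduct, Subgroup.mem_iInf]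
  refine forall₂_congr fun r _ => ?_
  constructor
  · rintro ⟨g, hg, rfl⟩
    exact ⟨_, hg, induces_partAction g⟩
  · rintro ⟨σ, hσ, h⟩
    refine ⟨⟨g, h.mem⟩, ?_, rfl⟩
    rw [← (induces_partAction ⟨g, h.mem⟩).unique h] at hσ
    exact hσ

/-- The permutations leaving every part of `r` invariant. -/
def partKernel (r : Setoid Ω) : Subgroup (Equiv.Perm Ω) :=
  (partAction r).ker.map (partitionStabilizer r).subtype

theorem mem_partKernel_iff_induces : g ∈ partKernel r ↔ Induces g r 1 := by
  constructor
  · rintro ⟨g, hg, rfl⟩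
    have := induces_partAction g
    rwa [MonoidHom.mem_ker.1 hg] at this
  · intro h
    exact ⟨⟨g, h.mem⟩, (induces_partAction _).unique h, rfl⟩

theorem mem_partKernel : g ∈ partKernel r ↔ ∀ x, r (g x) x := by
  rw [mem_partKernel_iff_induces]
  exact forall_congr' fun x => eq_comm.trans Quotient.eq

theorem mapPartition_apply {x y : Ω} : mapPartition g r x y ↔ r (g⁻¹ x) (g⁻¹ y) := Iff.rfl

theorem conj_mem_partKernel : h * g * h⁻¹ ∈ partKernel (mapPartition h r) ↔ g ∈ partKernel r := by
  simp only [mem_partKernel, mapPartition_apply, ← Equiv.Perm.mul_apply]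
  exact ⟨fun H x => by simpa [mul_assoc] using H (h x),
    fun H x => by simpa [mul_assoc] using H (h⁻¹ x)⟩

theorem conj_mem_partKernel_of_mem (hh : h ∈ partitionStabilizer r) (hg : g ∈ partKernel r) :
    h * g * h⁻¹ ∈ partKernel r := by
  have := (conj_mem_partKernel (h := h)).2 hg
  rwa [(mem_partitionStabilizer_iff r h).1 hh] at this

theorem mapPartition_mul : mapPartition (g * h) r = mapPartition g (mapPartition h r) := by
  ext x y
  simp only [mapPartition_apply, mul_inv_rev, Equiv.Perm.mul_apply]

theorem mapPartition_one : mapPartition 1 r = r := rfl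

theorem mapPartition_inv_mapPartition : mapPartition g⁻¹ (mapPartition g r) = r := by
  rw [← mapPartition_mul, inv_mul_cancel, mapPartition_one]

theorem mapPartition_mapPartition_inv : mapPartition g (mapPartition g⁻¹ r) = r := by
  rw [← mapPartition_mul, mul_inv_cancel, mapPartition_one]

end Induces

/-! ### Cartesian decompositions -/

namespace IsCartesianDecomposition

variable {Ω : Type*} {E : Set (Setoid Ω)} (hE : IsCartesianDecomposition E)

include hE

theorem eq_of_forall {x y : Ω} (h : ∀ r ∈ E, r x y) : x = y :=
  (hE.existsUnique fun r => Quotient.mk r.1 y).unique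
    (fun r => Quotient.eq.2 (h r.1 r.2)) fun _ => rfl

theorem perm_ext {g h : Equiv.Perm Ω} (H : ∀ r ∈ E, ∀ x, r (g x) (h x)) : g = h :=
  Equiv.ext fun x => hE.eq_of_forall fun r hr => H r hr x

/-- The identification of `Ω` with the Cartesian product of the sets of parts. -/
noncomputable def equivPi : Ω ≃ ∀ r : E, Quotient r.1 :=
  Equiv.ofBijective (fun x r => Quotient.mk r.1 x) <| by
    rw [Function.bijective_iff_existsUnique]
    intro γ
    simpa only [funext_iff] using hE.existsUnique γ

theorem exists_induces (σ : ∀ r : E, Equiv.Perm (Quotient r.1)) :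
    ∃ g : Equiv.Perm Ω, ∀ r : E, Induces g r.1 (σ r) := by
  refine ⟨(hE.equivPi.trans (Equiv.piCongrRight σ)).trans hE.equivPi.symm, fun r x => ?_⟩
  have h := hE.equivPi.apply_symm_apply (Equiv.piCongrRight σ (hE.equivPi x))
  exact (congrFun h r).symm

theorem exists_induces_single {r : Setoid Ω} (hr : r ∈ E) (σ : Equiv.Perm (Quotient r)) :
    ∃ g : Equiv.Perm Ω, Induces g r σ ∧ ∀ s ∈ E, s ≠ r → Induces g s 1 := by
  classical
  obtain ⟨g, hg⟩ := hE.exists_induces (Function.update (fun _ => 1) ⟨r, hr⟩ σ)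
  refine ⟨g, by simpa using hg ⟨r, hr⟩, fun s hs hsr => ?_⟩
  simpa [Function.update_of_ne (show (⟨s, hs⟩ : E) ≠ ⟨r, hr⟩ by simpa using hsr)] using hg ⟨s, hs⟩

end IsCartesianDecomposition

theorem IsCartesianDecomposition.nonempty {Ω : Type*} {E : Set (Setoid Ω)}
    (hE : IsCartesianDecomposition E) {r : Setoid Ω} (hr : r ∈ E) : Nonempty Ω := by
  by_contra hΩ
  rw [not_nonempty_iff] at hΩ
  exact (hE.proper r hr).2 (Setoid.eq_top_iff.2 fun x => isEmptyElim x)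

theorem IsCartesianDecomposition.exists_ne {Ω : Type*} {E : Set (Setoid Ω)}
    (hE : IsCartesianDecomposition E) {r : Setoid Ω} (hr : r ∈ E) : ∃ s ∈ E, s ≠ r := by
  by_contra! hall
  refine (hE.proper r hr).1 (Setoid.ext fun x y => ?_)
  refine ⟨fun hxy => hE.eq_of_forall fun s hs => hall s hs ▸ hxy, fun hxy => ?_⟩
  rw [show x = y from hxy]

/-! ### Blow-up decompositions: parts (a) and (b) -/

section BlowUp

variable {Ω : Type*} {G M N : Subgroup (Equiv.Perm Ω)} {E : Set (Setoid Ω)} {r : Setoid Ω}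

theorem NormalIn.component (hN : NormalIn N G) (r : Setoid Ω) :
    NormalIn (component N r) (component G r) where
  le σ hσ := by
    obtain ⟨n, hn, h⟩ := mem_component.1 hσ
    exact mem_component.2 ⟨n, hN.le hn, h⟩
  conj_mem τ hτ σ hσ := by
    obtain ⟨g, hg, h⟩ := mem_component.1 hτ
    obtain ⟨n, hn, h'⟩ := mem_component.1 hσ
    exact mem_component.2 ⟨_, hN.conj_mem g hg n hn, (h.mul h').mul h.inv⟩

theorem isPretransitive_component (hN : MulAction.IsPretransitive N Ω)
    (h : N ≤ partitionStabilizer r) : MulAction.IsPretransitive (component N r) (Quotient r) := by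
  rw [isPretransitive_iff] at hN ⊢
  intro p q
  induction p using Quotient.inductionOn with
  | h x =>
    induction q using Quotient.inductionOn with
    | h y =>
      obtain ⟨n, hn, rfl⟩ := hN x y
      exact ⟨_, mem_component.2 ⟨n, hn, induces_partAction ⟨n, h hn⟩⟩, rfl⟩

/-- The elements of `N` that act trivially on the parts of every partition in `E` except
possibly `r`. -/
def localPart (E : Set (Setoid Ω)) (N : Subgroup (Equiv.Perm Ω)) (r : Setoid Ω) :
    Subgroup (Equiv.Perm Ω) :=
  N ⊓ ⨅ s ∈ E \ {r}, partKernel s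

theorem mem_localPart {g : Equiv.Perm Ω} :
    g ∈ localPart E N r ↔ g ∈ N ∧ ∀ s ∈ E, s ≠ r → g ∈ partKernel s := by
  simp [localPart, Subgroup.mem_inf, Subgroup.mem_iInf]

theorem conj_mem_localPart (hinv : IsInvariant G E) (hN : NormalIn N G) {g c : Equiv.Perm Ω}
    (hg : g ∈ G) (hc : c ∈ localPart E N r) :
    g * c * g⁻¹ ∈ localPart E N (mapPartition g r) := by
  rw [mem_localPart] at hc ⊢
  refine ⟨hN.conj_mem g hg c hc.1, fun s hs hsr => ?_⟩
  have h := hc.2 (mapPartition g⁻¹ s) (hinv _ (inv_mem hg) s hs) fun h =>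
    hsr (by rw [← h, mapPartition_mapPartition_inv])
  rwa [← conj_mem_partKernel (h := g), mapPartition_mapPartition_inv] at h

theorem localPart_component_normalIn (hinv : IsInvariant G E) (hN : NormalIn N G) :
    NormalIn (component (localPart E N r) r) (component G r) where
  le σ hσ := by
    obtain ⟨n, hn, h⟩ := mem_component.1 hσ
    exact mem_component.2 ⟨n, hN.le (mem_localPart.1 hn).1, h⟩
  conj_mem τ hτ σ hσ := by
    obtain ⟨g, hg, h⟩ := mem_component.1 hτ
    obtain ⟨n, hn, h'⟩ := mem_component.1 hσ
    refine mem_component.2 ⟨_, ?_, (h.mul h').mul h.inv⟩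
    have := conj_mem_localPart hinv hN hg hn
    rwa [(mem_partitionStabilizer_iff r g).1 h.mem] at this

theorem eq_one_of_forall_conj_mem_partKernel (hE : IsCartesianDecomposition E)
    (htrans : IsTransitiveOn G E) (hr : r ∈ E) {c : Equiv.Perm Ω}
    (h : ∀ g ∈ G, g * c * g⁻¹ ∈ partKernel r) : c = 1 := by
  refine hE.perm_ext fun s hs => mem_partKernel.1 ?_
  obtain ⟨g, hg, rfl⟩ := htrans s hs r hr
  exact conj_mem_partKernel.1 (h g hg)

/-- Conjugation in `G` carries transitivity from `r` to every partition; the coordinates of a point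
are then corrected one at a time, without disturbing the others. -/
theorem isPretransitive_of_localPart [Finite Ω] (hE : IsCartesianDecomposition E)
    (hinv : IsInvariant G E) (htrans : IsTransitiveOn G E) (hr : r ∈ E) (hN : NormalIn N G)
    (h : MulAction.IsPretransitive (component (localPart E N r) r) (Quotient r)) :
    MulAction.IsPretransitive N Ω := by
  have hlocal : ∀ s ∈ E, ∀ x y, ∃ c ∈ localPart E N s, s (c x) y := by
    intro s hs x y
    obtain ⟨g, hg, rfl⟩ := htrans r hr s hs
    obtain ⟨σ, hσ, hxy⟩ := isPretransitive_iff.1 h (Quotient.mk r (g⁻¹ x)) (Quotient.mk r (g⁻¹ y))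
    obtain ⟨c, hc, hcσ⟩ := mem_component.1 hσ
    refine ⟨_, conj_mem_localPart hinv hN hg hc, ?_⟩
    rw [hcσ] at hxy
    rw [mapPartition_apply]
    simpa using Quotient.eq.1 hxy
  have hfin : E.Finite := E.toFinite
  rw [isPretransitive_iff]
  intro x y
  have key : ∀ F ⊆ E, F.Finite → ∃ n ∈ N, ∀ s ∈ F, s (n x) y := by
    intro F hF hFfin
    induction F, hFfin using Set.Finite.induction_on with
    | empty => exact ⟨1, one_mem N, by simp⟩
    | @insert s F hs _ ih =>
      obtain ⟨n, hn, hny⟩ := ih ((Set.subset_insert _ _).trans hF)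
      obtain ⟨c, hc, hcy⟩ := hlocal s (hF (Set.mem_insert _ _)) (n x) y
      rw [mem_localPart] at hc
      refine ⟨c * n, mul_mem hc.1 hn, fun s' hs' => ?_⟩
      by_cases hss : s' = s
      · subst hss
        exact hcy
      · have hs'F := hs'.resolve_left hss
        exact s'.trans' (mem_partKernel.1 (hc.2 s' (hF hs') hss) (n x)) (hny s' hs'F)
  obtain ⟨n, hn, hny⟩ := key E subset_rfl hfin
  exact ⟨n, hn, hE.eq_of_forall hny⟩

theorem mem_of_forall_exists_localPart [Finite Ω] (hE : IsCartesianDecomposition E) (hNM : N ≤ M)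
    (hlocal : ∀ s ∈ E, ∀ m ∈ M, ∃ c ∈ localPart E N s, c⁻¹ * m ∈ partKernel s)
    {σ : Equiv.Perm Ω} (hσ : ∀ s ∈ E, ∃ m ∈ M, m⁻¹ * σ ∈ partKernel s) : σ ∈ N := by
  have key : ∀ F ⊆ E, F.Finite → ∃ n ∈ N, ∀ s ∈ F, n⁻¹ * σ ∈ partKernel s := by
    intro F hF hFfin
    induction F, hFfin using Set.Finite.induction_on with
    | empty => exact ⟨1, one_mem N, by simp⟩
    | @insert s F hs _ ih =>
      obtain ⟨n, hn, hnσ⟩ := ih ((Set.subset_insert _ _).trans hF)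
      obtain ⟨m, hm, hmσ⟩ := hσ s (hF (Set.mem_insert _ _))
      obtain ⟨c, hc, hcm⟩ := hlocal s (hF (Set.mem_insert _ _)) (n⁻¹ * m)
        (mul_mem (inv_mem (hNM hn)) hm)
      rw [mem_localPart] at hc
      refine ⟨n * c, mul_mem hn hc.1, fun s' hs' => ?_⟩
      by_cases hss : s' = s
      · subst hss
        convert mul_mem hcm hmσ using 1
        group
      · rw [mul_inv_rev, mul_assoc]
        exact mul_mem (inv_mem (hc.2 s' (hF hs') hss)) (hnσ s' (hs'.resolve_left hss))
  obtain ⟨n, hn, hnσ⟩ := key E subset_rfl E.toFinite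
  have h1 : n⁻¹ * σ = 1 := hE.perm_ext fun s hs => mem_partKernel.1 (hnσ s hs)
  rw [inv_mul_eq_one] at h1
  exact h1 ▸ hn

/-- The elements of `M` all of whose `G`-conjugates induce an element of `B` on the parts
of `r`. -/
def normalLift (G M : Subgroup (Equiv.Perm Ω)) (B : Subgroup (Equiv.Perm (Quotient r))) :
    Subgroup (Equiv.Perm Ω) where
  carrier := {m | m ∈ M ∧ ∀ g ∈ G, ∃ σ ∈ B, Induces (g * m * g⁻¹) r σ}
  one_mem' := ⟨one_mem M, fun g _ => ⟨1, one_mem B, by simpa using induces_one⟩⟩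
  mul_mem' := fun {a b} ha hb => ⟨mul_mem ha.1 hb.1, fun g hg => by
    obtain ⟨σ, hσ, h1⟩ := ha.2 g hg
    obtain ⟨τ, hτ, h2⟩ := hb.2 g hg
    refine ⟨σ * τ, mul_mem hσ hτ, ?_⟩
    convert h1.mul h2 using 1
    group⟩
  inv_mem' := fun {a} ha => ⟨inv_mem ha.1, fun g hg => by
    obtain ⟨σ, hσ, h1⟩ := ha.2 g hg
    refine ⟨σ⁻¹, inv_mem hσ, ?_⟩
    convert h1.inv using 1
    group⟩

theorem normalLift_normalIn (hM : NormalIn M G) (B : Subgroup (Equiv.Perm (Quotient r))) :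
    NormalIn (normalLift G M B) G where
  le _ hm := hM.le hm.1
  conj_mem g hg m hm := by
    refine ⟨hM.conj_mem g hg m hm.1, fun k hk => ?_⟩
    obtain ⟨σ, hσ, h⟩ := hm.2 (k * g) (mul_mem hk hg)
    refine ⟨σ, hσ, ?_⟩
    convert h using 1
    group

/-- `E` is a blow-up decomposition for `G`, with respect to the normal subgroup `M`. -/
structure IsBlowUpVia (G M : Subgroup (Equiv.Perm Ω)) (E : Set (Setoid Ω)) : Prop where
  cartesian : IsCartesianDecomposition E
  invariant : IsInvariant G E
  transitiveOn : IsTransitiveOn G E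
  normalIn : NormalIn M G
  isPretransitive : MulAction.IsPretransitive M Ω
  fixes : ∀ r ∈ E, M ≤ partitionStabilizer r
  eq_directProduct : M = directProduct E (component M)
  component_eq : ∀ r ∈ E, component M r = permSocle (component G r)

theorem IsBlowUp.exists_via (h : IsBlowUp G E) : ∃ M, IsBlowUpVia G M E := by
  obtain ⟨h1, h2, h3, M, h4, h5, h6, h7⟩ := h
  exact ⟨M, h1, h2, h3, normalIn_of_subgroupOf_normal h4 h5, h6.transitive, h6.fixes,
    h6.eq_directProduct, h7⟩

namespace IsBlowUpVia

variable (h : IsBlowUpVia G M E)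

include h

theorem eq_directProduct_permSocle :
    M = directProduct E fun r => permSocle (component G r) := by
  ext g
  conv_lhs => rw [h.eq_directProduct]
  rw [mem_directProduct, mem_directProduct]
  exact forall₂_congr fun r hr => by rw [h.component_eq r hr]

theorem exists_single (hr : r ∈ E) {σ : Equiv.Perm (Quotient r)} (hσ : σ ∈ component M r) :
    ∃ m ∈ localPart E M r, Induces m r σ := by
  obtain ⟨g, hg, hg'⟩ := h.cartesian.exists_induces_single hr σ
  refine ⟨g, mem_localPart.2 ⟨?_, fun s hs hsr => mem_partKernel_iff_induces.2 (hg' s hs hsr)⟩, hg⟩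
  rw [h.eq_directProduct, mem_directProduct]
  intro s hs
  by_cases hsr : s = r
  · subst hsr
    exact ⟨σ, hσ, hg⟩
  · exact ⟨1, one_mem _, hg' s hs hsr⟩

theorem ne_bot (hr : r ∈ E) : M ≠ ⊥ := by
  rintro rfl
  refine (h.cartesian.proper r hr).2 (Setoid.eq_top_iff.2 fun x y => ?_)
  obtain ⟨n, hn, rfl⟩ := isPretransitive_iff.1 h.isPretransitive x y
  rw [Subgroup.mem_bot.1 hn]
  exact r.refl x

/-- Take `n ∈ M` with `n x = y` and cancel its action on `r` by an element of `M` supported on `r`.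
The coordinate at `r` is already right, since `x` and `y` share a part. -/
theorem exists_mem_partKernel (hr : r ∈ E) {x y : Ω} (hxy : r x y) :
    ∃ m ∈ M, m ∈ partKernel r ∧ m x = y := by
  obtain ⟨n, hn, rfl⟩ := isPretransitive_iff.1 h.isPretransitive x y
  have hnσ := induces_partAction ⟨n, h.fixes r hr hn⟩
  obtain ⟨m, hm, hmσ⟩ := h.exists_single hr (inv_mem (mem_component.2 ⟨n, hn, hnσ⟩))
  rw [mem_localPart] at hm
  have hker : m * n ∈ partKernel r := by
    rw [mem_partKernel_iff_induces, ← inv_mul_cancel (partAction r ⟨n, _⟩)]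
    exact hmσ.mul hnσ
  refine ⟨m * n, mul_mem hm.1 hn, hker, h.cartesian.eq_of_forall fun s hs => ?_⟩
  by_cases hsr : s = r
  · subst hsr
    exact s.trans' (mem_partKernel.1 hker x) hxy
  · exact mem_partKernel.1 (hm.2 s hs hsr) (n x)

/-- The parts of `r` are orbits of the kernel of `M` on `r`, and a permutation centralising `M`
permutes these orbits. -/
theorem centralizer_le_partitionStabilizer (hr : r ∈ E) :
    Subgroup.centralizer (M : Set (Equiv.Perm Ω)) ≤ partitionStabilizer r := by
  have key : ∀ c ∈ Subgroup.centralizer (M : Set (Equiv.Perm Ω)), ∀ x y, r x y → r (c x) (c y) := by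
    intro c hc x y hxy
    obtain ⟨m, hm, hker, rfl⟩ := h.exists_mem_partKernel hr hxy
    have h1 := Equiv.congr_fun (Subgroup.mem_centralizer_iff.1 hc m hm) x
    simp only [Equiv.Perm.mul_apply] at h1
    rw [← h1]
    exact r.symm' (mem_partKernel.1 hker (c x))
  intro c hc x y
  refine ⟨key c hc x y, fun hxy => ?_⟩
  simpa using key _ (inv_mem hc) _ _ hxy

theorem component_normalIn (r : Setoid Ω) : NormalIn (component M r) (component G r) :=
  h.normalIn.component r

theorem minNormalIn_le (hr : r ∈ E) {B : Subgroup (Equiv.Perm (Quotient r))}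
    (hB : MinNormalIn B (component G r)) : B ≤ component M r := by
  rw [h.component_eq r hr]
  exact hB.le_permSocle

theorem inf_centralizer_component_eq_bot [Finite Ω] (hr : r ∈ E)
    (hna : ∀ A, MinNormalIn A (component G r) →
      ¬ A ≤ Subgroup.centralizer (A : Set (Equiv.Perm (Quotient r)))) :
    component G r ⊓ Subgroup.centralizer (component M r : Set (Equiv.Perm (Quotient r))) = ⊥ := by
  by_contra hne
  obtain ⟨A, hA, hAle⟩ := exists_minNormalIn_le (h.component_normalIn r).centralizer hne
  exact hna A hA ((hAle.trans inf_le_right).trans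
    (Subgroup.centralizer_le (h.minNormalIn_le hr hA)))

theorem inf_centralizer_eq_bot [Finite Ω] (hr : r ∈ E)
    (hna : ∀ A, MinNormalIn A (component G r) →
      ¬ A ≤ Subgroup.centralizer (A : Set (Equiv.Perm (Quotient r)))) :
    G ⊓ Subgroup.centralizer (M : Set (Equiv.Perm Ω)) = ⊥ := by
  refine (Subgroup.eq_bot_iff_forall _).2 fun c hc =>
    eq_one_of_forall_conj_mem_partKernel h.cartesian h.transitiveOn hr fun g hg => ?_
  have hc' := h.normalIn.centralizer.conj_mem g hg c hc
  rw [Subgroup.mem_inf] at hc'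
  have hind := induces_partAction ⟨_, h.centralizer_le_partitionStabilizer hr hc'.2⟩
  rw [mem_partKernel_iff_induces]
  convert hind
  symm
  rw [← Subgroup.mem_bot, ← h.inf_centralizer_component_eq_bot hr hna]
  refine Subgroup.mem_inf.2 ⟨mem_component.2 ⟨_, hc'.1, hind⟩,
    Subgroup.mem_centralizer_iff.2 fun τ hτ => ?_⟩
  obtain ⟨m, hm, hmτ⟩ := mem_component.1 hτ
  refine (hmτ.mul hind).unique ?_
  rw [Subgroup.mem_centralizer_iff.1 hc'.2 m hm]
  exact hind.mul hmτ

theorem permSocle_le (hC : G ⊓ Subgroup.centralizer (M : Set (Equiv.Perm Ω)) ≤ M) :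
    permSocle G ≤ M := by
  rw [permSocle_eq_sSup]
  refine sSup_le fun K hK => ?_
  have hK' : MinNormalIn K G := hK
  rcases hK'.le_or_inf_eq_bot h.normalIn with h1 | h1
  · exact h1
  · exact (le_inf hK'.1.1.le (hK'.1.1.le_centralizer_of_inf_eq_bot h.normalIn h1)).trans hC

/-- The commutator of `n` with an element of `M` supported on `r` lies in `N`, is supported on `r`,
and induces the commutator of `σ` with `τ`. -/
theorem component_localPart_ne_bot (hr : r ∈ E) (hN : NormalIn N G) (hNM : N ≤ M)
    {n : Equiv.Perm Ω} (hn : n ∈ N) {σ τ : Equiv.Perm (Quotient r)} (hσ : Induces n r σ)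
    (hτ : τ ∈ component M r) (hne : τ * σ ≠ σ * τ) :
    component (localPart E N r) r ≠ ⊥ := by
  obtain ⟨m, hm, hmτ⟩ := h.exists_single hr hτ
  rw [mem_localPart] at hm
  have hc : n * m * n⁻¹ * m⁻¹ ∈ localPart E N r := by
    refine mem_localPart.2 ⟨(Subgroup.mem_inf.1
      (hN.commutator_mem_inf h.normalIn hn hm.1)).1, fun s hs hsr => ?_⟩
    exact mul_mem (conj_mem_partKernel_of_mem (h.fixes s hs (hNM hn)) (hm.2 s hs hsr))
      (inv_mem (hm.2 s hs hsr))
  intro hbot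
  have h1 : σ * τ * σ⁻¹ * τ⁻¹ ∈ component (localPart E N r) r :=
    mem_component.2 ⟨_, hc, ((hσ.mul hmτ).mul hσ.inv).mul hmτ.inv⟩
  rw [hbot, Subgroup.mem_bot, mul_inv_eq_one, mul_inv_eq_iff_eq_mul] at h1
  exact hne h1.symm

theorem exists_mem_not_mem_partKernel (hr : r ∈ E) (hN : NormalIn N G) (hN' : N ≠ ⊥) :
    ∃ n ∈ N, n ∉ partKernel r := by
  by_contra! hall
  exact hN' ((Subgroup.eq_bot_iff_forall _).2 fun n hn =>
    eq_one_of_forall_conj_mem_partKernel h.cartesian h.transitiveOn hr fun g hg =>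
      hall _ (hN.conj_mem g hg n hn))

/-- Since `C_G(M) = 1`, the group `N` meets `M` non-trivially. An element of `N ⊓ M` acting
non-trivially on `r` fails to commute with the socle of the component, so the commutator trick gives
a non-trivial, hence transitive, local part. -/
theorem isPretransitive_of_normalIn [Finite Ω] (hr : r ∈ E)
    (hq : MulAction.IsQuasiPreprimitive (component G r) (Quotient r))
    (hna : ∀ A, MinNormalIn A (component G r) →
      ¬ A ≤ Subgroup.centralizer (A : Set (Equiv.Perm (Quotient r))))
    (hN : NormalIn N G) (hN' : N ≠ ⊥) : MulAction.IsPretransitive N Ω := by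
  have hK := hN.inf h.normalIn
  have hK' : N ⊓ M ≠ ⊥ := fun hbot => hN' <| le_bot_iff.1 <| by
    rw [← h.inf_centralizer_eq_bot hr hna]
    exact le_inf hN.le (hN.le_centralizer_of_inf_eq_bot h.normalIn hbot)
  obtain ⟨n, hn, hnr⟩ := h.exists_mem_not_mem_partKernel hr hK hK'
  have hind := induces_partAction ⟨n, h.fixes r hr (Subgroup.mem_inf.1 hn).2⟩
  obtain ⟨τ, hτ, hne⟩ : ∃ τ ∈ component M r,
      τ * partAction r ⟨n, _⟩ ≠ partAction r ⟨n, _⟩ * τ := by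
    by_contra! hcomm
    refine hnr (mem_partKernel_iff_induces.2 ?_)
    convert hind
    symm
    rw [← Subgroup.mem_bot, ← h.inf_centralizer_component_eq_bot hr hna]
    exact Subgroup.mem_inf.2 ⟨mem_component.2 ⟨n, hK.le hn, hind⟩,
      Subgroup.mem_centralizer_iff.2 hcomm⟩
  have htr := isPretransitive_of_localPart h.cartesian h.invariant h.transitiveOn hr hK
    ((isQuasiPreprimitive_iff.1 hq).2 _ (localPart_component_normalIn h.invariant hK)
      (h.component_localPart_ne_bot hr hK inf_le_right hn hind hτ hne))
  rw [isPretransitive_iff] at htr ⊢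
  intro x y
  obtain ⟨k, hk, hxy⟩ := htr x y
  exact ⟨k, (Subgroup.mem_inf.1 hk).1, hxy⟩

theorem mem_normalLift_of_mem_localPart {B : Subgroup (Equiv.Perm (Quotient r))}
    (hr : r ∈ E) (hB : NormalIn B (component G r)) {m : Equiv.Perm Ω} (hm : m ∈ localPart E M r)
    {σ : Equiv.Perm (Quotient r)} (hσ : σ ∈ B) (hmσ : Induces m r σ) :
    m ∈ normalLift G M B := by
  rw [mem_localPart] at hm
  refine ⟨hm.1, fun g hg => ?_⟩
  -- Either `g` fixes `r` and normality of `B` applies, or the conjugate of `m` is supported on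
  -- another partition and acts trivially on `r`.
  by_cases hgr : mapPartition g⁻¹ r = r
  · have hgr' := (mem_partitionStabilizer_iff r _).2 hgr
    have hind := (induces_partAction ⟨_, hgr'⟩).inv
    rw [inv_inv] at hind
    exact ⟨_, hB.conj_mem _ (mem_component.2 ⟨g, hg, hind⟩) σ hσ, (hind.mul hmσ).mul hind.inv⟩
  · refine ⟨1, one_mem B, mem_partKernel_iff_induces.1 ?_⟩
    have h1 := hm.2 _ (h.invariant g⁻¹ (inv_mem hg) r hr) hgr
    rwa [← conj_mem_partKernel (h := g), mapPartition_mapPartition_inv] at h1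

theorem normalLift_ne_bot {B : Subgroup (Equiv.Perm (Quotient r))}
    (hr : r ∈ E) (hB : MinNormalIn B (component G r)) : normalLift G M B ≠ ⊥ := by
  intro hbot
  refine hB.1.2 ((Subgroup.eq_bot_iff_forall _).2 fun σ hσ => ?_)
  obtain ⟨m, hm, hmσ⟩ := h.exists_single hr (h.minNormalIn_le hr hB hσ)
  have h1 := h.mem_normalLift_of_mem_localPart hr hB.1.1 hm hσ hmσ
  rw [hbot, Subgroup.mem_bot] at h1
  subst h1
  exact hmσ.unique induces_one

theorem isQuasiPreprimitive_component [Finite Ω]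
    (hr : r ∈ E) (hq : MulAction.IsQuasiPreprimitive G Ω) :
    MulAction.IsQuasiPreprimitive (component G r) (Quotient r) := by
  rw [isQuasiPreprimitive_iff] at hq ⊢
  have htr := isPretransitive_component h.isPretransitive (h.fixes r hr)
  refine ⟨?_, fun N hN hN' => ?_⟩
  · rw [isPretransitive_iff] at htr ⊢
    intro p q
    obtain ⟨σ, hσ, hpq⟩ := htr p q
    exact ⟨σ, (h.component_normalIn r).le hσ, hpq⟩
  · obtain ⟨B, hB, hBN⟩ := exists_minNormalIn_le hN hN'
    have hlift := hq.2 _ (normalLift_normalIn h.normalIn B) (h.normalLift_ne_bot hr hB)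
    rw [isPretransitive_iff] at hlift ⊢
    intro p q
    induction p using Quotient.inductionOn with
    | h x =>
      induction q using Quotient.inductionOn with
      | h y =>
        obtain ⟨m, hm, rfl⟩ := hlift x y
        obtain ⟨σ, hσ, hmσ⟩ := hm.2 1 (one_mem G)
        refine ⟨σ, hBN hσ, ?_⟩
        simpa using hmσ x

theorem le_of_component_le [Finite Ω] (hr : r ∈ E) (hN : NormalIn N G) (hNM : N ≤ M)
    (hle : component M r ≤ component (localPart E N r) r) : M ≤ N := by
  have hlocal : ∀ s ∈ E, ∀ m ∈ M, ∃ c ∈ localPart E N s, c⁻¹ * m ∈ partKernel s := by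
    intro s hs m hm
    obtain ⟨g, hg, rfl⟩ := h.transitiveOn r hr s hs
    have hm' := h.normalIn.conj_mem _ (inv_mem hg) m hm
    have hind := induces_partAction ⟨_, h.fixes r hr hm'⟩
    obtain ⟨c, hc, hcσ⟩ := mem_component.1 (hle (mem_component.2 ⟨_, hm', hind⟩))
    refine ⟨_, conj_mem_localPart h.invariant hN hg hc, ?_⟩
    have h1 := (mem_partKernel_iff_induces (r := r)).2
      (by simpa only [inv_mul_cancel] using hcσ.inv.mul hind)
    rw [← conj_mem_partKernel (h := g)] at h1
    convert h1 using 1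
    group
  exact fun m hm => mem_of_forall_exists_localPart h.cartesian hNM hlocal fun s _ =>
    ⟨m, hm, by simp⟩

/-- `Soc G ≤ M` because `C_G(M) = 1`. Conversely, for `B` minimal normal in the component, a minimal
normal subgroup of `G` inside the lift of `B` has a local part that is non-trivial by the commutator
trick, hence all of `B`. So the local part of `Soc G` induces the whole socle. -/
theorem permSocle_eq_of_nonabelian [Finite Ω] (hr : r ∈ E)
    (hna : ∀ A, MinNormalIn A (component G r) →
      ¬ A ≤ Subgroup.centralizer (A : Set (Equiv.Perm (Quotient r)))) :
    permSocle G = M := by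
  have hle : permSocle G ≤ M := h.permSocle_le ((h.inf_centralizer_eq_bot hr hna).le.trans bot_le)
  refine le_antisymm hle (h.le_of_component_le hr (permSocle_normalIn G) hle ?_)
  rw [h.component_eq r hr]
  conv_lhs => rw [permSocle_eq_sSup]
  refine sSup_le fun B hB => ?_
  have hB' : MinNormalIn B (component G r) := hB
  obtain ⟨N, hN, hNB⟩ := exists_minNormalIn_le (normalLift_normalIn h.normalIn B)
    (h.normalLift_ne_bot hr hB')
  have hNM : N ≤ M := hNB.trans fun m hm => hm.1
  obtain ⟨n, hn, hnr⟩ := h.exists_mem_not_mem_partKernel hr hN.1.1 hN.1.2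
  obtain ⟨σ, hσ, hnσ⟩ := (hNB hn).2 1 (one_mem G)
  rw [one_mul, inv_one, mul_one] at hnσ
  obtain ⟨τ, hτ, hne⟩ : ∃ τ ∈ B, τ * σ ≠ σ * τ := by
    by_contra! hcomm
    rcases hB'.le_or_inf_eq_bot hB'.1.1.centralizer with h1 | h1
    · exact hna B hB' (h1.trans inf_le_right)
    · refine hnr (mem_partKernel_iff_induces.2 ?_)
      have : σ ∈ B ⊓ (component G r ⊓ Subgroup.centralizer (B : Set _)) :=
        Subgroup.mem_inf.2 ⟨hσ, Subgroup.mem_inf.2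
          ⟨hB'.1.1.le hσ, Subgroup.mem_centralizer_iff.2 hcomm⟩⟩
      rw [h1, Subgroup.mem_bot] at this
      exact this ▸ hnσ
  have hL := h.component_localPart_ne_bot hr hN.1.1 hNM hn hnσ (h.minNormalIn_le hr hB' hτ) hne
  have hLB : component (localPart E N r) r ≤ B := by
    intro ρ hρ
    obtain ⟨c, hc, hcρ⟩ := mem_component.1 hρ
    obtain ⟨ρ', hρ', hcρ'⟩ := (hNB (mem_localPart.1 hc).1).2 1 (one_mem G)
    rw [one_mul, inv_one, mul_one] at hcρ'
    rwa [hcρ.unique hcρ']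
  rw [← hB'.eq_of_le (localPart_component_normalIn h.invariant hN.1.1) hL hLB]
  intro ρ hρ
  obtain ⟨c, hc, hcρ⟩ := mem_component.1 hρ
  rw [mem_localPart] at hc
  exact mem_component.2 ⟨c, mem_localPart.2 ⟨hN.le_permSocle hc.1, hc.2⟩, hcρ⟩

/-- The component's socle is the self-centralising `A`, so `M` is abelian and transitive, hence
self-centralising, which gives `Soc G ≤ M`. A minimal normal `N ≤ M` of `G` is transitive and
abelian too, so `M ≤ C(N) ≤ N`. -/
theorem permSocle_eq_of_abelian [Finite Ω] (hr : r ∈ E)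
    (hq : MulAction.IsQuasiPreprimitive G Ω) {A : Subgroup (Equiv.Perm (Quotient r))}
    (hA : MinNormalIn A (component G r))
    (hcomm : A ≤ Subgroup.centralizer (A : Set (Equiv.Perm (Quotient r)))) :
    permSocle G = M := by
  have hΩ := h.cartesian.nonempty hr
  have : Nonempty (Quotient r) := hΩ.map (Quotient.mk r)
  have hq' := isQuasiPreprimitive_iff.1 (h.isQuasiPreprimitive_component hr hq)
  have hCA := centralizer_le_of_isPretransitive (hq'.2 A hA.1.1 hA.1.2) hcomm
  have hSA : component M r ≤ A := by
    rw [h.component_eq r hr, permSocle_eq_sSup]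
    refine sSup_le fun B hB => ?_
    have hB' : MinNormalIn B (component G r) := hB
    rcases hB'.le_or_inf_eq_bot hA.1.1 with h1 | h1
    · exact h1
    · exact (hB'.1.1.le_centralizer_of_inf_eq_bot hA.1.1 h1).trans hCA
  have hMcomm : M ≤ Subgroup.centralizer (M : Set (Equiv.Perm Ω)) := by
    intro m hm
    refine Subgroup.mem_centralizer_iff.2 fun n hn => ?_
    rw [← mul_inv_eq_iff_eq_mul, ← mul_inv_eq_one]
    refine eq_one_of_forall_conj_mem_partKernel h.cartesian h.transitiveOn hr fun g hg => ?_
    have hm' := h.normalIn.conj_mem g hg m hm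
    have hn' := h.normalIn.conj_mem g hg n hn
    have hmσ := induces_partAction ⟨_, h.fixes r hr hm'⟩
    have hnσ := induces_partAction ⟨_, h.fixes r hr hn'⟩
    have h1 := Subgroup.mem_centralizer_iff.1 (hcomm (hSA (mem_component.2 ⟨_, hm', hmσ⟩))) _
      (hSA (mem_component.2 ⟨_, hn', hnσ⟩))
    rw [← mul_inv_eq_iff_eq_mul, ← mul_inv_eq_one] at h1
    have h2 := ((hnσ.mul hmσ).mul hnσ.inv).mul hmσ.inv
    rw [h1] at h2
    rw [mem_partKernel_iff_induces]
    convert h2 using 1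
    group
  have hCM := centralizer_le_of_isPretransitive h.isPretransitive hMcomm
  refine le_antisymm (h.permSocle_le (inf_le_right.trans hCM)) ?_
  obtain ⟨N, hN, hNM⟩ := exists_minNormalIn_le h.normalIn (h.ne_bot hr)
  have hNcomm := Subgroup.centralizer_le (G := Equiv.Perm Ω) (SetLike.coe_subset_coe.2 hNM)
  exact (hMcomm.trans (hNcomm.trans (centralizer_le_of_isPretransitive
    ((isQuasiPreprimitive_iff.1 hq).2 N hN.1.1 hN.1.2) (hNM.trans (hMcomm.trans hNcomm))))).trans
    hN.le_permSocle

end IsBlowUpVia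

theorem isQuasiprimitiveHA_of_minNormalIn {H A : Subgroup (Equiv.Perm Ω)} [Nonempty Ω]
    (hH : MulAction.IsQuasiPreprimitive H Ω) (hA : MinNormalIn A H)
    (hcomm : A ≤ Subgroup.centralizer (A : Set (Equiv.Perm Ω))) : IsQuasiprimitiveHA H := by
  have htr := (isQuasiPreprimitive_iff.1 hH).2 A hA.1.1 hA.1.2
  refine ⟨hH, A.subgroupOf H, hA.isMinimalNormal_subgroupOf, ⟨⟨fun a b => ?_⟩⟩, ?_, ⟨fun x y => ?_⟩,
    fun ω => (Subgroup.eq_bot_iff_forall _).2 fun a ha => ?_, ?_⟩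
  · exact Subtype.ext (Subtype.ext (Subgroup.mem_centralizer_iff.1 (hcomm b.2) _ a.2))
  · ext c
    constructor
    · intro hc
      refine centralizer_le_of_isPretransitive htr hcomm
        (Subgroup.mem_centralizer_iff.2 fun a ha => ?_)
      exact congrArg Subtype.val (Subgroup.mem_centralizer_iff.1 hc ⟨a, hA.1.1.le ha⟩ ha)
    · intro hc
      refine Subgroup.mem_centralizer_iff.2 fun a ha => Subtype.ext ?_
      exact Subgroup.mem_centralizer_iff.1 (hcomm hc) a ha
  · obtain ⟨a, ha, hxy⟩ := isPretransitive_iff.1 htr x y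
    exact ⟨⟨⟨a, hA.1.1.le ha⟩, ha⟩, hxy⟩
  · exact Subtype.ext (Subtype.ext (eq_one_of_mem_centralizer htr (hcomm a.2) (x := ω) ha))
  · rw [Subgroup.map_subgroupOf_eq_of_le hA.1.1.le]
    intro g hg
    refine Subgroup.mem_normalizer_iff.2 fun a => ⟨hA.1.1.conj_mem g hg a, fun ha => ?_⟩
    have := hA.1.1.conj_mem _ (inv_mem hg) _ ha
    convert this using 1
    group

end BlowUp

/-! ### Complements, homomorphic images and the counting argument -/

section Quotients

variable {M : Type*} [Group M]

/-- The product of the minimal normal subgroups not contained in `K`. -/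
def socleComplement (K : Subgroup M) : Subgroup M :=
  sSup {T | IsMinimalNormal T ∧ ¬ T ≤ K}

theorem socleComplement_normal (K : Subgroup M) : (socleComplement K).Normal := by
  refine ⟨fun n hn g => ?_⟩
  suffices h : socleComplement K ≤ (socleComplement K).comap (MulAut.conj g).toMonoidHom by
    simpa using h hn
  refine sSup_le fun T hT x hx => ?_
  exact (le_sSup hT : T ≤ socleComplement K) (hT.1.normal.conj_mem x hx g)

theorem socleComplement_le_centralizer {K T : Subgroup M} (hT : IsMinimalNormal T) (h : T ≤ K) :
    socleComplement K ≤ Subgroup.centralizer (T : Set M) :=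
  sSup_le fun _ hT' => hT'.1.le_centralizer hT fun heq => hT'.2 (heq ▸ h)

namespace IsCenterlessSocle

variable (hM : IsCenterlessSocle M)

include hM

theorem isCompl_socleComplement {K : Subgroup M} (hK : K.Normal) :
    IsCompl (socleComplement K) K := by
  refine IsCompl.of_eq ((Subgroup.eq_bot_iff_forall _).2 fun x hx =>
    hM.eq_one_of_forall_commute fun T hT => ?_) ?_
  · rw [Subgroup.mem_inf] at hx
    by_cases hTK : T ≤ K
    · exact socleComplement_le_centralizer hT hTK hx.1
    · exact (not_not.1 ((hM.le_iff_not_le_centralizer hT hK).not.1 hTK)) hx.2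
  · rw [eq_top_iff, ← hM.socle_eq_top]
    refine sSup_le fun T hT => ?_
    by_cases hTK : T ≤ K
    · exact hTK.trans le_sup_right
    · exact (le_sSup (show T ∈ {T | IsMinimalNormal T ∧ ¬ T ≤ K} from ⟨hT, hTK⟩)).trans le_sup_left

theorem exists_mul_socleComplement {K : Subgroup M} (hK : K.Normal) (x : M) :
    ∃ n ∈ socleComplement K, ∃ k ∈ K, n * k = x := by
  have := hK
  refine Subgroup.mem_sup_of_normal_right.1 ?_
  rw [(hM.isCompl_socleComplement hK).sup_eq_top]
  trivial

theorem exists_isMinimalNormal_le_not_le {K L : Subgroup M} (hK : K.Normal) (hL : L.Normal)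
    (hKL : K ≤ L) (hLK : ¬ L ≤ K) : ∃ T, IsMinimalNormal T ∧ T ≤ L ∧ ¬ T ≤ K := by
  by_contra! hall
  refine hLK fun x hx => ?_
  obtain ⟨n, hn, k, hk, rfl⟩ := hM.exists_mul_socleComplement hK x
  have hnL : n ∈ L := by simpa using mul_mem hx (inv_mem (hKL hk))
  have : n = 1 := hM.eq_one_of_forall_commute fun T hT => by
    by_cases hTK : T ≤ K
    · exact socleComplement_le_centralizer hT hTK hn
    · exact (not_not.1 ((hM.le_iff_not_le_centralizer hT hL).not.1 fun h => hTK (hall T hT h))) hnL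
  rw [this, one_mul]
  exact hk

variable {M' : Type*} [Group M'] {f : M →* M'}

theorem not_isMulCommutative_of_not_le_ker {T : Subgroup M} (hT : IsMinimalNormal T)
    (hTf : ¬ T ≤ f.ker) : ¬ IsMulCommutative M' := by
  intro hcomm
  refine hM.not_le_centralizer_self hT fun x hx => Subgroup.mem_centralizer_iff.2 fun y hy => ?_
  have hdis := (hT.le_or_disjoint (K := f.ker) inferInstance).resolve_left hTf
  have h1 : x * y * x⁻¹ * y⁻¹ ∈ T ⊓ f.ker := by
    refine Subgroup.mem_inf.2 ⟨mul_mem (mul_mem (mul_mem hx hy) (inv_mem hx)) (inv_mem hy),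
      MonoidHom.mem_ker.2 ?_⟩
    rw [map_mul, map_mul, map_mul, hcomm.is_comm.comm (f x) (f y), map_inv, map_inv,
      mul_inv_cancel_right, mul_inv_cancel]
  rw [hdis.eq_bot, Subgroup.mem_bot, mul_inv_eq_one, mul_inv_eq_iff_eq_mul] at h1
  exact h1.symm

theorem not_isSimpleGroup_of_not_le_ker (hf : Function.Surjective f) {T T' : Subgroup M}
    (hT : IsMinimalNormal T) (hT' : IsMinimalNormal T') (hTf : ¬ T ≤ f.ker) (hTf' : ¬ T' ≤ f.ker)
    (hne : T ≠ T') : ¬ IsSimpleGroup M' := by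
  intro hsimple
  have key : ∀ S : Subgroup M, IsMinimalNormal S → ¬ S ≤ f.ker → S.map f = ⊤ := fun S hS hSf =>
    (hsimple.eq_bot_or_eq_top_of_normal _ (hS.normal.map f hf)).resolve_left fun h =>
      hSf ((Subgroup.map_eq_bot_iff S).1 h)
  refine hM.not_isMulCommutative_of_not_le_ker hT hTf ⟨⟨fun a b => ?_⟩⟩
  obtain ⟨x, hx, rfl⟩ : a ∈ T.map f := by rw [key T hT hTf]; trivial
  obtain ⟨y, hy, rfl⟩ : b ∈ T'.map f := by rw [key T' hT' hTf']; trivial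
  rw [← map_mul, ← map_mul, Subgroup.mem_centralizer_iff.1 (hT.le_centralizer hT' hne hx) y hy]

/-- Every minimal normal subgroup of the image is the image of some minimal normal `T`, and the
image of `C(T)` centralises it. -/
theorem isFullProj_map (hf : Function.Surjective f) {K : Subgroup M} (hK : IsFullProj K) :
    IsFullProj (K.map f) := by
  intro S hS
  obtain ⟨T, hT, hTS, hTf⟩ := hM.exists_isMinimalNormal_le_not_le (K := f.ker) (L := S.comap f)
    inferInstance (hS.normal.comap f) (fun x hx => by
      rw [Subgroup.mem_comap, MonoidHom.mem_ker.1 hx]; exact one_mem S) fun h => hS.ne_bot (by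
      rw [← Subgroup.map_comap_eq_self_of_surjective hf S]
      exact (Subgroup.map_eq_bot_iff _).2 h)
  have hTS' : T.map f = S := hS.eq_of_le (hT.normal.map f hf)
    (fun h => hTf ((Subgroup.map_eq_bot_iff T).1 h)) (Subgroup.map_le_iff_le_comap.2 hTS)
  have h1 := congrArg (Subgroup.map f) (hK T hT)
  rw [Subgroup.map_sup, Subgroup.map_top_of_surjective f hf] at h1
  rw [eq_top_iff, ← h1]
  refine sup_le_sup_left ?_ _
  rintro _ ⟨c, hc, rfl⟩
  refine Subgroup.mem_centralizer_iff.2 fun s hs => ?_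
  rw [← hTS'] at hs
  obtain ⟨t, ht, rfl⟩ := hs
  rw [← map_mul, ← map_mul, Subgroup.mem_centralizer_iff.1 hc t ht]

variable [Finite M] {t : ℕ}
  (ht : ∀ T : Subgroup M, IsMinimalNormal T → (Subgroup.centralizer (T : Set M)).index = t)

include ht

/-- A subdirect subgroup with `κ` kernels has index `t ^ (k - κ)`, so the product formula for
indices becomes additive in `k - κ`. The bound `2 (k - κ)` on the missing factors is then summed
over `i`; it is strict because `H` has at least one kernel. -/
theorem sum_ncard_not_le_lt {T₀ : Subgroup M} (hT₀ : IsMinimalNormal T₀) {ι : Type*} [Fintype ι]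
    {K : ι → Subgroup M} (hK : ∀ i, IsFullProj (K i)) {H : Subgroup M} (hH : IsFullProj H)
    (hprod : ∏ i, (K i).index = H.index) :
    ∑ i, {T : Subgroup M | IsMinimalNormal T ∧ ¬ T ≤ K i}.ncard <
      2 * {T : Subgroup M | IsMinimalNormal T}.ncard := by
  set k := {T : Subgroup M | IsMinimalNormal T}.ncard with hk
  have ht1 : 1 < t := by
    have h0 : t ≠ 0 := by
      rw [← ht T₀ hT₀]; exact Subgroup.index_ne_zero_of_finite
    have h1 : t ≠ 1 := by
      rw [← ht T₀ hT₀]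
      intro h
      exact hM.not_le_centralizer_self hT₀ (Subgroup.index_eq_one.1 h ▸ le_top)
    omega
  have hcard : Nat.card M = t ^ k := by
    rw [hk, ← hM.ncard_projKernels_top, ← hM.card_eq_pow ht IsFullProj.top, Subgroup.card_top]
  have hle : ∀ L : Subgroup M, (projKernels L).ncard ≤ k := fun L =>
    Set.ncard_image_le (Set.toFinite _)
  have hidx : ∀ L : Subgroup M, IsFullProj L → L.index = t ^ (k - (projKernels L).ncard) := by
    intro L hL
    have h1 := L.card_mul_index
    rw [hM.card_eq_pow ht hL, hcard, ← Nat.add_sub_of_le (hle L), pow_add] at h1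
    rw [Nat.eq_of_mul_eq_mul_left (by positivity) h1]
  have hsum : ∑ i, (k - (projKernels (K i)).ncard) = k - (projKernels H).ncard := by
    apply Nat.pow_right_injective ht1
    change t ^ _ = t ^ _
    rw [← hidx H hH, ← hprod, ← Finset.prod_pow_eq_pow_sum]
    exact Finset.prod_congr rfl fun i _ => (hidx _ (hK i)).symm
  have hH0 : 0 < (projKernels H).ncard :=
    (Set.ncard_pos (Set.toFinite _)).2 ⟨_, T₀, hT₀, rfl⟩
  have hk0 : 0 < k := hH0.trans_le (hle H)
  calc ∑ i, {T : Subgroup M | IsMinimalNormal T ∧ ¬ T ≤ K i}.ncard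
      ≤ ∑ i, 2 * (k - (projKernels (K i)).ncard) := by
        refine Finset.sum_le_sum fun i _ => ?_
        have := hM.two_mul_ncard_projKernels_add ht (hK i)
        omega
    _ = 2 * (k - (projKernels H).ncard) := by rw [← Finset.mul_sum, hsum]
    _ < 2 * k := by omega

/-- By `hconj` the number of `i` with `T ≰ K i` does not depend on `T`. If it were at least two,
double counting would give at least `2 k` pairs. -/
theorem eq_of_not_le_of_not_le {ι : Type*} [Finite ι]
    {K : ι → Subgroup M} (hK : ∀ i, IsFullProj (K i)) {H : Subgroup M} (hH : IsFullProj H)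
    (hprod : ∏ᶠ i, (K i).index = H.index)
    (hconj : ∀ T T' : Subgroup M, IsMinimalNormal T → IsMinimalNormal T' →
      ∃ π : Equiv.Perm ι, ∀ i, T ≤ K i ↔ T' ≤ K (π i))
    {T : Subgroup M} (hT : IsMinimalNormal T) {i j : ι} (hi : ¬ T ≤ K i) (hj : ¬ T ≤ K j) :
    i = j := by
  classical
  by_contra hne
  have := Fintype.ofFinite ι
  have := Fintype.ofFinite (Subgroup M)
  rw [finprod_eq_prod_of_fintype] at hprod
  have h1 := hM.sum_ncard_not_le_lt ht hT hK hH hprod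
  let D := Finset.univ.filter fun T : Subgroup M => IsMinimalNormal T
  have hD : {T : Subgroup M | IsMinimalNormal T}.ncard = D.card := by
    rw [← Set.ncard_coe_finset]; congr 1; ext; simp [D]
  have h2 : ∀ i, {T : Subgroup M | IsMinimalNormal T ∧ ¬ T ≤ K i}.ncard =
      (D.bipartiteAbove (fun i T => ¬ T ≤ K i) i).card := by
    intro i
    rw [← Set.ncard_coe_finset]; congr 1; ext; simp [D, Finset.bipartiteAbove]
  rw [Finset.sum_congr rfl fun i _ => h2 i,
    Finset.sum_card_bipartiteAbove_eq_sum_card_bipartiteBelow, hD, mul_comm, ← smul_eq_mul] at h1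
  refine absurd h1 (not_lt.2 (Finset.card_nsmul_le_sum _ _ _ fun S hS => ?_))
  have hS' : IsMinimalNormal S := (Finset.mem_filter.1 hS).2
  obtain ⟨π, hπ⟩ := hconj T S hT hS'
  refine Finset.one_lt_card.2 ⟨π i, ?_, π j, ?_, π.injective.ne hne⟩
  · simpa [Finset.bipartiteBelow] using (hπ i).not.1 hi
  · simpa [Finset.bipartiteBelow] using (hπ j).not.1 hj

end IsCenterlessSocle

theorem index_centralizer_map_le [Finite M] (T : Subgroup M) (e : M ≃* M) :
    (Subgroup.centralizer (T.map e.toMonoidHom : Set M)).index ≤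
      (Subgroup.centralizer (T : Set M)).index := by
  rw [← Subgroup.index_map_equiv (Subgroup.centralizer (T : Set M)) e]
  refine Nat.le_of_dvd (Nat.pos_of_ne_zero Subgroup.index_ne_zero_of_finite)
    (Subgroup.index_dvd_of_le ?_)
  rintro _ ⟨c, hc, rfl⟩
  refine Subgroup.mem_centralizer_iff.2 ?_
  rintro _ ⟨t, ht, rfl⟩
  change e t * e c = e c * e t
  rw [← map_mul, ← map_mul, Subgroup.mem_centralizer_iff.1 hc t ht]

theorem IsMinimalNormal.exists_index_centralizer_eq {G : Type*} [Group G] [Finite G]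
    {N : Subgroup G} (hN : IsMinimalNormal N) (hS : IsCenterlessSocle N) :
    ∃ t, ∀ T : Subgroup N, IsMinimalNormal T →
      (Subgroup.centralizer (T : Set N)).index = t := by
  have := hN.normal
  by_cases hex : ∃ T : Subgroup N, IsMinimalNormal T
  · obtain ⟨T, hT⟩ := hex
    have key : ∀ T T' : Subgroup N, IsMinimalNormal T → IsMinimalNormal T' →
        (Subgroup.centralizer (T' : Set N)).index ≤ (Subgroup.centralizer (T : Set N)).index := by
      intro T T' hT hT'
      obtain ⟨g, rfl⟩ := hN.exists_conj hS hT hT'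
      exact index_centralizer_map_le _ _
    exact ⟨_, fun T' hT' => le_antisymm (key T T' hT hT') (key T' T hT' hT)⟩
  · push Not at hex
    -- Any value would serve here.
    exact ⟨0, fun T hT => (hex T hT).elim⟩

end Quotients

/-! ### Subdirect plinths preserving a Cartesian decomposition -/

section Plinth

variable {Ω : Type*} {G : Subgroup (Equiv.Perm Ω)} {M : Subgroup G} {E : Set (Setoid Ω)}
  {r : Setoid Ω}

/-- The action of `G` on an invariant set of partitions. -/
def partitionsAction (hinv : IsInvariant G E) : G →* Equiv.Perm E where
  toFun g :=
    { toFun := fun r => ⟨mapPartition g r, hinv g g.2 r r.2⟩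
      invFun := fun r => ⟨mapPartition g⁻¹ r, hinv _ (inv_mem g.2) r r.2⟩
      left_inv := fun _ => Subtype.ext mapPartition_inv_mapPartition
      right_inv := fun _ => Subtype.ext mapPartition_mapPartition_inv }
  map_one' := rfl
  map_mul' _ _ := Equiv.ext fun _ => Subtype.ext mapPartition_mul

theorem card_eq_pow_of_isHomogeneous [Finite Ω] (hE : IsCartesianDecomposition E)
    (hhom : IsHomogeneous E) (hr : r ∈ E) : Nat.card Ω = Nat.card (Quotient r) ^ Nat.card E := by
  have := Fintype.ofFinite E
  rw [Nat.card_congr hE.equivPi, Nat.card_pi, Finset.prod_congr rfl fun s _ => hhom s.1 s.2 r hr,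
    Finset.prod_const, Finset.card_univ, Nat.card_eq_fintype_card (α := E)]

theorem IsCartesianDecomposition.one_lt_card [Finite Ω] (hE : IsCartesianDecomposition E)
    (hr : r ∈ E) : 1 < Nat.card (Quotient r) := by
  by_contra! hle
  have h1 := Finite.card_le_one_iff_subsingleton.1 hle
  exact (hE.proper r hr).2 (Setoid.eq_top_iff.2 fun x y =>
    Quotient.eq.1 (Subsingleton.elim (Quotient.mk r x) (Quotient.mk r y)))

/-- By Legendre's formula, a prime occurs in `n!` with exponent less than `n`. -/
theorem not_pow_dvd_factorial {k n : ℕ} (hk : 1 < k) (hn : n ≠ 0) : ¬ k ^ n ∣ n.factorial := by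
  intro h
  obtain ⟨p, hp, hpk⟩ := Nat.exists_prime_and_dvd hk.ne'
  have : Fact p.Prime := ⟨hp⟩
  have h1 := (pow_dvd_pow_of_dvd hpk n).trans h
  rw [padicValNat_dvd_iff_le (Nat.factorial_ne_zero n)] at h1
  exact absurd (padicValNat_factorial_lt_of_ne_zero (p := p) hn) (not_lt.2 h1)

/-- Otherwise minimality makes `M` faithful on the set of partitions, and the order `|Γ| ^ |E|` of
`Ω` divides `|M|`, which divides `|E|!`. -/
theorem IsMinimalNormal.fixes_partitions [Finite Ω] (hM : IsMinimalNormal M)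
    (htr : MulAction.IsPretransitive M Ω) (hE : IsCartesianDecomposition E)
    (hhom : IsHomogeneous E) (hinv : IsInvariant G E) (hr : r ∈ E) (m : M) :
    ((m : G) : Equiv.Perm Ω) ∈ partitionStabilizer r := by
  have key : M ≤ (partitionsAction hinv).ker := by
    refine (hM.le_or_disjoint inferInstance).resolve_right fun hdis => ?_
    have hinj : Function.Injective ((partitionsAction hinv).comp M.subtype) := by
      rw [← MonoidHom.ker_eq_bot_iff, Subgroup.eq_bot_iff_forall]
      intro x hx
      have : (x : G) ∈ M ⊓ (partitionsAction hinv).ker := Subgroup.mem_inf.2 ⟨x.2, hx⟩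
      rw [hdis.eq_bot, Subgroup.mem_bot] at this
      exact Subtype.ext this
    have hΩ := hE.nonempty hr
    obtain ⟨ω⟩ := hΩ
    have h1 : Nat.card Ω ∣ Nat.card M := by
      rw [← MulAction.index_stabilizer_of_transitive M ω]
      exact Subgroup.index_dvd_card _
    have h2 := h1.trans (Subgroup.card_dvd_of_injective _ hinj)
    rw [Nat.card_perm, card_eq_pow_of_isHomogeneous hE hhom hr] at h2
    have : Nonempty E := ⟨⟨r, hr⟩⟩
    exact not_pow_dvd_factorial (hE.one_lt_card hr) Nat.card_pos.ne' h2
  rw [mem_partitionStabilizer_iff]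
  exact congrArg Subtype.val (Equiv.congr_fun (MonoidHom.mem_ker.1 (key m.2)) ⟨r, hr⟩)

/-- The action on the parts of `r` of a subgroup leaving `r` invariant. -/
def partHom (h : ∀ m : M, ((m : G) : Equiv.Perm Ω) ∈ partitionStabilizer r) :
    M →* Equiv.Perm (Quotient r) :=
  (partAction r).comp ((G.subtype.comp M.subtype).codRestrict (partitionStabilizer r) h)

/-- The stabiliser of a part of `r`. -/
def partStab (h : ∀ m : M, ((m : G) : Equiv.Perm Ω) ∈ partitionStabilizer r) (q : Quotient r) :
    Subgroup M :=
  (MulAction.stabilizer (Equiv.Perm (Quotient r)) q).comap (partHom h)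

section

variable (h : ∀ m : M, ((m : G) : Equiv.Perm Ω) ∈ partitionStabilizer r)

theorem induces_partHom (m : M) : Induces ((m : G) : Equiv.Perm Ω) r (partHom h m) :=
  fun _ => rfl

theorem partHom_range : (partHom h).range = component (M.map G.subtype) r := by
  ext σ
  rw [mem_component]
  constructor
  · rintro ⟨m, rfl⟩
    exact ⟨_, ⟨m, m.2, rfl⟩, induces_partHom h m⟩
  · rintro ⟨_, ⟨m, hm, rfl⟩, hσ⟩
    exact ⟨⟨m, hm⟩, (induces_partHom h ⟨m, hm⟩).unique hσ⟩

theorem mem_partHom_ker {m : M} :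
    m ∈ (partHom h).ker ↔ ((m : G) : Equiv.Perm Ω) ∈ partKernel r := by
  rw [MonoidHom.mem_ker, mem_partKernel_iff_induces]
  exact ⟨fun h' => h' ▸ induces_partHom h m, fun h' => (induces_partHom h m).unique h'⟩

theorem mem_partStab {q : Quotient r} {m : M} : m ∈ partStab h q ↔ partHom h m q = q := Iff.rfl

theorem stabilizer_le_partStab (ω : Ω) : MulAction.stabilizer M ω ≤ partStab h (Quotient.mk r ω) :=
  fun _ hm => congrArg (Quotient.mk r) (MulAction.mem_stabilizer_iff.1 hm)

theorem ker_le_partStab (q : Quotient r) : (partHom h).ker ≤ partStab h q := by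
  intro m hm
  rw [mem_partStab, MonoidHom.mem_ker.1 hm]
  rfl

theorem exists_partHom_eq (htr : MulAction.IsPretransitive M Ω) (p q : Quotient r) :
    ∃ m : M, partHom h m p = q := by
  induction p using Quotient.inductionOn with
  | h x =>
    induction q using Quotient.inductionOn with
    | h y =>
      obtain ⟨m, rfl⟩ := htr.exists_smul_eq x y
      exact ⟨m, rfl⟩

/-- A normal subgroup of a transitive group that fixes one point fixes all of them. -/
theorem le_partStab_iff (htr : MulAction.IsPretransitive M Ω) {T : Subgroup M} (hT : T.Normal)
    (q : Quotient r) : T ≤ partStab h q ↔ T ≤ (partHom h).ker := by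
  refine ⟨fun hle t ht => MonoidHom.mem_ker.2 (Equiv.ext fun p => ?_),
    fun hle => hle.trans (ker_le_partStab h q)⟩
  obtain ⟨m, rfl⟩ := exists_partHom_eq h htr q p
  have h1 := (mem_partStab h).1 (hle (hT.conj_mem t ht m⁻¹))
  rw [map_mul, map_mul, map_inv, inv_inv, Equiv.Perm.mul_apply, Equiv.Perm.mul_apply,
    Equiv.Perm.inv_eq_iff_eq] at h1
  exact h1

theorem index_partStab (htr : MulAction.IsPretransitive M Ω) (q : Quotient r) :
    (partStab h q).index = Nat.card (Quotient r) := by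
  let _ := MulAction.compHom (Quotient r) (partHom h)
  have htr' : MulAction.IsPretransitive M (Quotient r) := ⟨exists_partHom_eq h htr⟩
  exact MulAction.index_stabilizer_of_transitive M q

end

/-- `M` is a non-abelian minimal normal subgroup of `G`, transitive and with subdirect point
stabilisers, that leaves every partition of the invariant Cartesian decomposition `E`
invariant. -/
structure IsSubdirectPlinth (G : Subgroup (Equiv.Perm Ω)) (M : Subgroup G)
    (E : Set (Setoid Ω)) : Prop where
  cartesian : IsCartesianDecomposition E
  invariant : IsInvariant G E
  minimal : IsMinimalNormal M
  centerless : IsCenterlessSocle M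
  isPretransitive : MulAction.IsPretransitive M Ω
  fixes : ∀ r ∈ E, ∀ m : M, ((m : G) : Equiv.Perm Ω) ∈ partitionStabilizer r
  fullProj : ∀ ω : Ω, IsFullProj (MulAction.stabilizer M ω)

namespace IsSubdirectPlinth

variable (h : IsSubdirectPlinth G M E)

include h

theorem fullProj_partStab (hr : r ∈ E) (q : Quotient r) :
    IsFullProj (partStab (h.fixes r hr) q) := by
  induction q using Quotient.inductionOn with
  | h ω => exact (h.fullProj ω).mono (stabilizer_le_partStab _ ω)

theorem map_conj_le_ker_iff [M.Normal] (hr : r ∈ E) (g : G) (T : Subgroup M) :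
    T.map (MulAut.conjNormal g : MulAut M).toMonoidHom ≤
      (partHom (h.fixes _ (h.invariant g g.2 r hr))).ker ↔ T ≤ (partHom (h.fixes r hr)).ker := by
  rw [Subgroup.map_le_iff_le_comap]
  refine forall₂_congr fun t _ => ?_
  rw [Subgroup.mem_comap, mem_partHom_ker, mem_partHom_ker]
  exact conj_mem_partKernel

theorem exists_isMinimalNormal_not_le_ker (hr : r ∈ E) :
    ∃ T, IsMinimalNormal T ∧ ¬ T ≤ (partHom (h.fixes r hr)).ker := by
  by_contra! hall
  have h1 : (⊤ : Subgroup M) ≤ (partHom (h.fixes r hr)).ker := by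
    rw [← h.centerless.socle_eq_top]
    exact sSup_le hall
  refine (h.cartesian.proper r hr).2 (Setoid.eq_top_iff.2 fun x y => ?_)
  obtain ⟨m, rfl⟩ := h.isPretransitive.exists_smul_eq x y
  exact r.symm' (mem_partKernel.1 ((mem_partHom_ker _).1 (h1 (Subgroup.mem_top m))) x)

/-- The counting argument applied to the stabilisers of the parts containing `ω`: the product
formula is `|Ω| = ∏ |Γ|`, and conjugation in `G` moves factors and partitions compatibly. -/
theorem eq_of_not_le_ker [Finite Ω] {T : Subgroup M} (hT : IsMinimalNormal T) {s : Setoid Ω}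
    (hr : r ∈ E) (hs : s ∈ E) (hTr : ¬ T ≤ (partHom (h.fixes r hr)).ker)
    (hTs : ¬ T ≤ (partHom (h.fixes s hs)).ker) : r = s := by
  have := h.minimal.normal
  have hΩ := h.cartesian.nonempty hr
  obtain ⟨ω⟩ := hΩ
  obtain ⟨t, ht⟩ := h.minimal.exists_index_centralizer_eq h.centerless
  let K : E → Subgroup M := fun r => partStab (h.fixes r.1 r.2) (Quotient.mk r.1 ω)
  have hprod : ∏ᶠ r : E, (K r).index = (MulAction.stabilizer M ω).index := by
    have := Fintype.ofFinite E
    have := h.isPretransitive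
    rw [MulAction.index_stabilizer_of_transitive M ω, Nat.card_congr h.cartesian.equivPi,
      Nat.card_pi, finprod_eq_prod_of_fintype]
    exact Finset.prod_congr rfl fun r _ => index_partStab _ h.isPretransitive _
  have hconj : ∀ T T' : Subgroup M, IsMinimalNormal T → IsMinimalNormal T' →
      ∃ π : Equiv.Perm E, ∀ r, T ≤ K r ↔ T' ≤ K (π r) := by
    intro T T' hT hT'
    obtain ⟨g, rfl⟩ := h.minimal.exists_conj h.centerless hT hT'
    refine ⟨partitionsAction h.invariant g, fun r => ?_⟩
    rw [le_partStab_iff _ h.isPretransitive hT.normal, le_partStab_iff _ h.isPretransitive hT'.normal]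
    exact (h.map_conj_le_ker_iff r.2 g T).symm
  have h1 := h.centerless.eq_of_not_le_of_not_le ht (K := K)
    (fun r => h.fullProj_partStab r.2 _) (h.fullProj ω) hprod hconj hT (i := ⟨r, hr⟩) (j := ⟨s, hs⟩)
    ((le_partStab_iff _ h.isPretransitive hT.normal _).not.2 hTr)
    ((le_partStab_iff _ h.isPretransitive hT.normal _).not.2 hTs)
  exact congrArg Subtype.val h1

theorem mapPartition_eq_of_not_le_ker [Finite Ω] [M.Normal] {T T' : Subgroup M} {s : Setoid Ω}
    (hT' : IsMinimalNormal T') (hr : r ∈ E) (hs : s ∈ E)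
    (hTr : ¬ T ≤ (partHom (h.fixes r hr)).ker) (hTs : ¬ T' ≤ (partHom (h.fixes s hs)).ker) {g : G}
    (hg : T.map (MulAut.conjNormal g : MulAut M).toMonoidHom = T') : mapPartition g r = s := by
  refine h.eq_of_not_le_ker hT' (h.invariant g g.2 r hr) hs ?_ hTs
  rwa [← hg, h.map_conj_le_ker_iff hr]

theorem isTransitiveOn [Finite Ω] : IsTransitiveOn G E := by
  intro r hr s hs
  have := h.minimal.normal
  obtain ⟨T, hT, hTr⟩ := h.exists_isMinimalNormal_not_le_ker hr
  obtain ⟨T', hT', hTs⟩ := h.exists_isMinimalNormal_not_le_ker hs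
  obtain ⟨g, hg⟩ := h.minimal.exists_conj h.centerless hT hT'
  exact ⟨g, g.2, h.mapPartition_eq_of_not_le_ker hT' hr hs hTr hTs hg⟩

theorem socleComplement_le_ker [Finite Ω] {s : Setoid Ω} (hr : r ∈ E) (hs : s ∈ E) (hne : s ≠ r) :
    socleComplement (partHom (h.fixes r hr)).ker ≤ (partHom (h.fixes s hs)).ker := by
  refine sSup_le fun T hT => ?_
  by_contra hTs
  exact hne (h.eq_of_not_le_ker hT.1 hs hr hTs hT.2)

theorem exists_mem_localPart [Finite Ω] (hr : r ∈ E) {m : Equiv.Perm Ω} (hm : m ∈ M.map G.subtype) :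
    ∃ c ∈ localPart E (M.map G.subtype) r, c⁻¹ * m ∈ partKernel r := by
  obtain ⟨m, hm, rfl⟩ := hm
  obtain ⟨n, hn, k, hk, hnk⟩ := h.centerless.exists_mul_socleComplement
    (K := (partHom (h.fixes r hr)).ker) inferInstance ⟨m, hm⟩
  refine ⟨n.1.1, mem_localPart.2 ⟨⟨n, n.2, rfl⟩, fun s hs hsr =>
    (mem_partHom_ker _).1 (h.socleComplement_le_ker hr hs hsr hn)⟩, ?_⟩
  have : m = (n : G) * k := (congrArg Subtype.val hnk).symm
  subst this
  simpa using (mem_partHom_ker _).1 hk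

/-- The factors acting non-trivially on `r` act trivially elsewhere, so every action of `M` on `r`
is realised by an element supported on `r`. -/
theorem eq_directProduct [Finite Ω] :
    M.map G.subtype = directProduct E (component (M.map G.subtype)) := by
  apply le_antisymm
  · rintro _ ⟨m, hm, rfl⟩
    refine mem_directProduct.2 fun r hr => ⟨_, ?_, induces_partHom (h.fixes r hr) ⟨m, hm⟩⟩
    rw [← partHom_range (h.fixes r hr)]
    exact ⟨_, rfl⟩
  · intro σ hσ
    refine mem_of_forall_exists_localPart h.cartesian le_rfl
      (fun s hs m hm => h.exists_mem_localPart hs hm) fun s hs => ?_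
    obtain ⟨ρ, hρ, hσρ⟩ := mem_directProduct.1 hσ s hs
    obtain ⟨m, hm, hmρ⟩ := mem_component.1 hρ
    refine ⟨m, hm, mem_partKernel_iff_induces.2 ?_⟩
    simpa only [inv_mul_cancel] using hmρ.inv.mul hσρ

theorem isNormalFor [Finite Ω] : IsNormalFor (M.map G.subtype) E where
  transitive := by
    refine isPretransitive_iff.2 fun x y => ?_
    obtain ⟨m, hm⟩ := h.isPretransitive.exists_smul_eq x y
    exact ⟨_, ⟨m, m.2, rfl⟩, hm⟩
  fixes r hr := by
    rintro _ ⟨m, hm, rfl⟩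
    exact h.fixes r hr ⟨m, hm⟩
  complement r hr := by
    let e := M.equivMapOfInjective G.subtype G.subtype_injective
    have h1 := h.centerless.isCompl_socleComplement (K := (partHom (h.fixes r hr)).ker) inferInstance
    refine ⟨(socleComplement (partHom (h.fixes r hr)).ker).map e.toMonoidHom,
      (socleComplement_normal _).map _ e.surjective, ?_⟩
    have h2 : (partKernel r).subgroupOf (M.map G.subtype) =
        (partHom (h.fixes r hr)).ker.map e.toMonoidHom := by
      ext x
      obtain ⟨m, rfl⟩ := e.surjective x
      rw [Subgroup.mem_subgroupOf]
      refine (mem_partHom_ker (h.fixes r hr)).symm.trans ⟨fun hm => ⟨m, hm, rfl⟩, ?_⟩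
      rintro ⟨m', hm', heq⟩
      rwa [← e.injective heq]
    change IsCompl _ ((partKernel r).subgroupOf _)
    rw [h2]
    exact h1.map e.mapSubgroup
  eq_directProduct := h.eq_directProduct

end IsSubdirectPlinth
end Plinth

/-! ### Minimal normal subgroups with trivial centraliser -/

section UniqueMinimal

variable {Ω : Type*} {H S : Subgroup (Equiv.Perm Ω)}

theorem MinNormalIn.le_of_centralizer_eq_bot (hS : MinNormalIn S H)
    (hC : H ⊓ Subgroup.centralizer (S : Set (Equiv.Perm Ω)) = ⊥) {N : Subgroup (Equiv.Perm Ω)}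
    (hN : NormalIn N H) (hN' : N ≠ ⊥) : S ≤ N := by
  refine (hS.le_or_inf_eq_bot hN).resolve_right fun h => hN' (le_bot_iff.1 ?_)
  rw [← hC]
  exact le_inf hN.le (hN.le_centralizer_of_inf_eq_bot hS.1.1 (inf_comm N S ▸ h))

theorem MinNormalIn.permSocle_eq (hS : MinNormalIn S H)
    (hC : H ⊓ Subgroup.centralizer (S : Set (Equiv.Perm Ω)) = ⊥) : permSocle H = S := by
  refine le_antisymm ?_ hS.le_permSocle
  rw [permSocle_eq_sSup]
  refine sSup_le fun N hN => ?_
  have hN' : MinNormalIn N H := hN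
  exact (hN'.eq_of_le hS.1.1 hS.1.2 (hS.le_of_centralizer_eq_bot hC hN'.1.1 hN'.1.2)).ge

theorem MinNormalIn.isQuasiPreprimitive (hS : MinNormalIn S H)
    (hC : H ⊓ Subgroup.centralizer (S : Set (Equiv.Perm Ω)) = ⊥)
    (htr : MulAction.IsPretransitive S Ω) : MulAction.IsQuasiPreprimitive H Ω := by
  have key : ∀ N, S ≤ N → MulAction.IsPretransitive N Ω := by
    intro N hSN
    rw [isPretransitive_iff] at htr ⊢
    intro x y
    obtain ⟨s, hs, hxy⟩ := htr x y
    exact ⟨s, hSN hs, hxy⟩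
  exact isQuasiPreprimitive_iff.2 ⟨key H hS.1.1.le,
    fun N hN hN' => key N (hS.le_of_centralizer_eq_bot hC hN hN')⟩

end UniqueMinimal

/-! ### Components of a subdirect plinth: parts (c) and (d) -/

section Plinth

variable {Ω : Type*} [Finite Ω] {G : Subgroup (Equiv.Perm Ω)} {M : Subgroup G}
  {E : Set (Setoid Ω)} {r : Setoid Ω}

namespace IsSubdirectPlinth

variable (h : IsSubdirectPlinth G M E)

include h

theorem isPretransitive_component (hr : r ∈ E) :
    MulAction.IsPretransitive (component (M.map G.subtype) r) (Quotient r) :=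
  PermCartesian.isPretransitive_component h.isNormalFor.transitive (h.isNormalFor.fixes r hr)

/-- If `σ` centralises the component of `M` and `m q = σ q`, then `q` and `m q` have the same
stabiliser in `M`. So `m` normalises the stabiliser of `q`, which is self-normalising; hence `σ q =
q`, and `σ` is trivial by semiregularity. -/
theorem centralizer_component_eq_bot (hr : r ∈ E) :
    Subgroup.centralizer (component (M.map G.subtype) r : Set (Equiv.Perm (Quotient r))) = ⊥ := by
  refine (Subgroup.eq_bot_iff_forall _).2 fun σ hσ => ?_
  obtain ⟨t, ht⟩ := h.minimal.exists_index_centralizer_eq h.centerless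
  obtain ⟨T, hT, hTr⟩ := h.exists_isMinimalNormal_not_le_ker hr
  have hQ : Nonempty (Quotient r) := (h.cartesian.nonempty hr).map (Quotient.mk r)
  obtain ⟨q⟩ := hQ
  obtain ⟨m, hm⟩ := exists_partHom_eq (h.fixes r hr) h.isPretransitive q (σ q)
  have hmem : m ∈ partStab (h.fixes r hr) q := by
    refine h.centerless.mem_of_forall_conj_mem ht (h.fullProj_partStab hr q) fun x => ?_
    have hcomm : partHom (h.fixes r hr) (m * x * m⁻¹) (σ q) =
        σ (partHom (h.fixes r hr) (m * x * m⁻¹) q) :=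
      Equiv.congr_fun (Subgroup.mem_centralizer_iff.1 hσ _
        ((partHom_range (h.fixes r hr)).le ⟨m * x * m⁻¹, rfl⟩)) q
    rw [mem_partStab, mem_partStab, ← σ.injective.eq_iff (a := partHom _ (m * x * m⁻¹) q), ← hcomm,
      ← hm, ← Equiv.Perm.mul_apply, ← map_mul, inv_mul_cancel_right, map_mul, Equiv.Perm.mul_apply,
      (partHom (h.fixes r hr) m).injective.eq_iff]
  refine eq_one_of_mem_centralizer (h.isPretransitive_component hr) hσ (x := q) ?_
  rw [← hm]
  exact hmem

theorem minNormalIn_component (hr : r ∈ E) :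
    MinNormalIn (component (M.map G.subtype) r) (component G r) := by
  have hMn := h.minimal.normal
  have hnormal := (normalIn_map_subtype hMn).component r
  obtain ⟨T₀, hT₀, hTr₀⟩ := h.exists_isMinimalNormal_not_le_ker hr
  refine ⟨⟨hnormal, fun hbot => hTr₀ fun t _ => ?_⟩, fun L hL hLS => ?_⟩
  · have := (partHom_range (h.fixes r hr)).le ⟨t, rfl⟩
    rw [hbot] at this
    exact this
  · let f := partHom (h.fixes r hr)
    have hLn : (L.comap f).Normal := by
      refine ⟨fun n hn m => ?_⟩
      rw [Subgroup.mem_comap, map_mul, map_mul, map_inv]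
      exact hL.1.conj_mem _ (hnormal.le ((partHom_range (h.fixes r hr)).le ⟨m, rfl⟩)) _ hn
    have hker : f.ker ≤ L.comap f := fun x hx => by
      rw [Subgroup.mem_comap, MonoidHom.mem_ker.1 hx]; exact one_mem L
    obtain ⟨T, hT, hTL, hTr⟩ := h.centerless.exists_isMinimalNormal_le_not_le (K := f.ker)
      (L := L.comap f) inferInstance hLn hker fun hle => hL.2 <| by
        refine (Subgroup.eq_bot_iff_forall _).2 fun σ hσ => ?_
        obtain ⟨m, rfl⟩ := (partHom_range (h.fixes r hr)).ge (hLS hσ)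
        exact hle hσ
    have htop : L.comap f = ⊤ := by
      rw [eq_top_iff, ← h.centerless.socle_eq_top]
      refine sSup_le fun T' hT' => ?_
      by_cases hT'r : T' ≤ f.ker
      · exact hT'r.trans hker
      · obtain ⟨g, hg⟩ := h.minimal.exists_conj h.centerless hT hT'
        -- Both factors act non-trivially on `r` and on no other partition, so an element of `G`
        -- conjugating one to the other fixes `r`, and its induced permutation normalises `L`.
        have hgr := h.mapPartition_eq_of_not_le_ker hT' hr hr hTr hT'r hg
        rw [← mem_partitionStabilizer_iff] at hgr
        rw [← hg]
        rintro _ ⟨t, ht, rfl⟩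
        have hind := induces_partAction ⟨_, hgr⟩
        have h1 := hL.1.conj_mem _ (mem_component.2 ⟨g, g.2, hind⟩) _ (hTL ht)
        have h2 := (hind.mul (induces_partHom (h.fixes r hr) t)).mul hind.inv
        rw [Subgroup.mem_comap]
        convert h1
        exact (induces_partHom (h.fixes r hr) _).unique h2
    rw [← partHom_range (h.fixes r hr)]
    rintro _ ⟨m, rfl⟩
    have : m ∈ L.comap f := htop ▸ Subgroup.mem_top m
    exact this

theorem inf_centralizer_component (hr : r ∈ E) : component G r ⊓ Subgroup.centralizer
    (component (M.map G.subtype) r : Set (Equiv.Perm (Quotient r))) = ⊥ := by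
  rw [h.centralizer_component_eq_bot hr, inf_bot_eq]

theorem isBlowUp : IsBlowUp G E := by
  refine ⟨h.cartesian, h.invariant, h.isTransitiveOn, M.map G.subtype, Subgroup.map_subtype_le M,
    (normalIn_map_subtype h.minimal.normal).subgroupOf_normal, h.isNormalFor, fun r hr => ?_⟩
  exact ((h.minNormalIn_component hr).permSocle_eq (h.inf_centralizer_component hr)).symm

/-- A factor acting non-trivially on `r` lies outside the subdirect part stabiliser, so another
factor shares its projection kernel and lies outside as well. This is why the component's socle is
not simple. -/
theorem exists_pair_not_le_ker (hr : r ∈ E) : ∃ T T' : Subgroup M, IsMinimalNormal T ∧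
    IsMinimalNormal T' ∧ ¬ T ≤ (partHom (h.fixes r hr)).ker ∧
    ¬ T' ≤ (partHom (h.fixes r hr)).ker ∧ T ≠ T' := by
  obtain ⟨t, ht⟩ := h.minimal.exists_index_centralizer_eq h.centerless
  obtain ⟨T, hT, hTr⟩ := h.exists_isMinimalNormal_not_le_ker hr
  have hQ : Nonempty (Quotient r) := (h.cartesian.nonempty hr).map (Quotient.mk r)
  obtain ⟨q⟩ := hQ
  have hK := h.fullProj_partStab hr q
  have hTK := (le_partStab_iff _ h.isPretransitive hT.normal q).not.2 hTr
  rw [h.centerless.le_iff_isolated ht hK hT] at hTK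
  push Not at hTK
  obtain ⟨T', hT', heq, hne⟩ := hTK
  refine ⟨T, T', hT, hT', hTr, ?_, hne.symm⟩
  rw [← le_partStab_iff (h.fixes r hr) h.isPretransitive hT'.normal q,
    h.centerless.le_iff_isolated ht hK hT']
  exact fun hall => hne (hall T hT heq.symm).symm

theorem isQuasiprimitive_component (hr : r ∈ E) :
    IsQuasiprimitiveSd (component G r) ∨ IsQuasiprimitiveCd (component G r) := by
  have hS := h.minNormalIn_component hr
  have hq := hS.isQuasiPreprimitive (h.inf_centralizer_component hr) (h.isPretransitive_component hr)
  let S := (component (M.map G.subtype) r).subgroupOf (component G r)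
  have hS' : IsMinimalNormal S := hS.isMinimalNormal_subgroupOf
  have hmem : ∀ m, partHom (h.fixes r hr) m ∈ component (M.map G.subtype) r := fun m =>
    (partHom_range (h.fixes r hr)).le ⟨m, rfl⟩
  let f : M →* S := ((partHom (h.fixes r hr)).codRestrict (component G r)
    fun m => hS.1.1.le (hmem m)).codRestrict S hmem
  have hf : Function.Surjective f := by
    rintro ⟨⟨σ, hσ⟩, hσ'⟩
    obtain ⟨m, rfl⟩ := (partHom_range (h.fixes r hr)).ge hσ'
    exact ⟨m, rfl⟩
  have hker : f.ker = (partHom (h.fixes r hr)).ker := by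
    ext m
    rw [MonoidHom.mem_ker, MonoidHom.mem_ker]
    exact ⟨fun h1 => congrArg (fun x : S => x.1.1) h1, fun h1 => Subtype.ext (Subtype.ext h1)⟩
  obtain ⟨T, T', hT, hT', hTr, hTr', hne⟩ := h.exists_pair_not_le_ker hr
  rw [← hker] at hTr hTr'
  have hcomm := h.centerless.not_isMulCommutative_of_not_le_ker hT hTr
  have hsimple := h.centerless.not_isSimpleGroup_of_not_le_ker hf hT hT' hTr hTr' hne
  have hcenterless : IsCenterlessSocle S := hS'.isCenterlessSocle hcomm
  have hcent : Subgroup.centralizer (S : Set (component G r)) = ⊥ := by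
    refine (Subgroup.eq_bot_iff_forall _).2 fun c hc => Subtype.ext ?_
    have : c.1 ∈ component G r ⊓ Subgroup.centralizer
        (component (M.map G.subtype) r : Set (Equiv.Perm (Quotient r))) :=
      Subgroup.mem_inf.2 ⟨c.2, Subgroup.mem_centralizer_iff.2 fun s hs =>
        congrArg Subtype.val (Subgroup.mem_centralizer_iff.1 hc ⟨s, hS.1.1.le hs⟩ hs)⟩
    rwa [h.inf_centralizer_component hr] at this
  have hsub : ∀ q : Quotient r, IsSubdirect (MulAction.stabilizer S q) := by
    intro q
    rw [hcenterless.isSubdirect_iff]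
    refine (h.centerless.isFullProj_map hf (h.fullProj_partStab hr q)).mono ?_
    rintro _ ⟨m, hm, rfl⟩
    exact hm
  have htr : MulAction.IsPretransitive S (Quotient r) := ⟨fun p q => by
    obtain ⟨m, hm⟩ := exists_partHom_eq (h.fixes r hr) h.isPretransitive p q
    exact ⟨f m, hm⟩⟩
  -- Point stabilisers in the transitive group `S` are conjugate, so they are all simple or none is.
  by_cases hex : ∃ q : Quotient r, IsSimpleGroup (MulAction.stabilizer S q)
  · obtain ⟨q, hsq⟩ := hex
    refine Or.inl ⟨hq, S, hS', hcomm, hsimple, hcent, fun p => ⟨?_, hsub p⟩⟩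
    obtain ⟨s, hs⟩ := htr.exists_smul_eq p q
    exact (MulAction.stabilizerEquivStabilizer hs.symm).isSimpleGroup
  · push Not at hex
    exact Or.inr ⟨hq, S, hS', hcomm, hsimple, hcent, fun p => ⟨hex p, hsub p⟩⟩

/-- There is a second partition `s`, on which a factor `T` active on `r` is trivial. A simple
subdirect `M_ω` would meet `C(T)` trivially, whereas the part of `M_ω` supported on `s` centralises
`T`; it would be trivial, contradicting subdirectness at `s`. -/
theorem not_isSimpleGroup_stabilizer (hr : r ∈ E) (ω : Ω) :
    ¬ IsSimpleGroup (MulAction.stabilizer M ω) := by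
  intro hsimple
  obtain ⟨T, hT, hTr⟩ := h.exists_isMinimalNormal_not_le_ker hr
  obtain ⟨s, hs, hsr⟩ := h.cartesian.exists_ne hr
  obtain ⟨T', hT', hTs'⟩ := h.exists_isMinimalNormal_not_le_ker hs
  have hTs : T ≤ (partHom (h.fixes s hs)).ker := by
    by_contra hTs
    exact hsr (h.eq_of_not_le_ker hT hs hr hTs hTr)
  have hTn := hT.normal
  have hinf : ∀ x ∈ MulAction.stabilizer M ω, x ∈ Subgroup.centralizer (T : Set M) → x = 1 := by
    intro x hx hxT
    rcases hsimple.eq_bot_or_eq_top_of_normal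
      ((Subgroup.centralizer (T : Set M)).subgroupOf (MulAction.stabilizer M ω)) inferInstance
      with h1 | h1
    · have : (⟨x, hx⟩ : MulAction.stabilizer M ω) ∈
          (Subgroup.centralizer (T : Set M)).subgroupOf (MulAction.stabilizer M ω) := hxT
      rw [h1, Subgroup.mem_bot] at this
      exact congrArg Subtype.val this
    · have h2 := h.fullProj ω T hT
      rw [sup_eq_right.2 (Subgroup.subgroupOf_eq_top.1 h1)] at h2
      exact (h.centerless.not_le_centralizer_self hT (h2 ▸ le_top)).elim
  -- Modulo the kernel on `s`, an element fixing the part of `ω` can be taken supported on `s`. It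
  -- then fixes `ω` and centralises `T`, so it is trivial.
  have hle : partStab (h.fixes s hs) (Quotient.mk s ω) ≤ (partHom (h.fixes s hs)).ker := by
    intro x hx
    obtain ⟨n, hn, k, hk, rfl⟩ := h.centerless.exists_mul_socleComplement
      (K := (partHom (h.fixes s hs)).ker) inferInstance x
    have hnK : n ∈ partStab (h.fixes s hs) (Quotient.mk s ω) := by
      simpa using mul_mem hx (inv_mem (ker_le_partStab _ _ hk))
    have : n = 1 := by
      refine hinf n ?_ (socleComplement_le_centralizer hT hTs hn)
      refine h.cartesian.eq_of_forall fun s' hs' => ?_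
      by_cases hss : s' = s
      · subst hss
        exact Quotient.eq.1 hnK
      · exact mem_partKernel.1 ((mem_partHom_ker (h.fixes s' hs')).1
          (h.socleComplement_le_ker hs hs' hss hn)) ω
    rwa [this, one_mul]
  have h3 := h.fullProj_partStab hs (Quotient.mk s ω) T' hT'
  have h4 := (h.centerless.le_iff_not_le_centralizer hT'
    (inferInstance : (partHom (h.fixes s hs)).ker.Normal)).not.1 hTs'
  rw [sup_eq_right.2 (hle.trans (not_not.1 h4))] at h3
  exact h.centerless.not_le_centralizer_self hT' (h3 ▸ le_top)

end IsSubdirectPlinth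

theorem IsMinimalNormal.isSubdirectPlinth (hM : IsMinimalNormal M)
    (hcomm : ¬ IsMulCommutative M) (hq : MulAction.IsQuasiPreprimitive G Ω)
    (hsub : ∀ ω : Ω, IsSubdirect (MulAction.stabilizer M ω)) (hE : IsCartesianDecomposition E)
    (hhom : IsHomogeneous E) (hinv : IsInvariant G E) : IsSubdirectPlinth G M E := by
  have hS := hM.isCenterlessSocle hcomm
  have htr : MulAction.IsPretransitive M Ω := by
    have h1 := (isQuasiPreprimitive_iff.1 hq).2 _ (isMinimalNormal_iff.1 hM).1.1
      (isMinimalNormal_iff.1 hM).1.2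
    refine ⟨fun x y => ?_⟩
    obtain ⟨_, ⟨m, hm, rfl⟩, hxy⟩ := isPretransitive_iff.1 h1 x y
    exact ⟨⟨m, hm⟩, hxy⟩
  exact ⟨hE, hinv, hM, hS, htr, fun r hr => hM.fixes_partitions htr hE hhom hinv hr,
    fun ω => hS.isSubdirect_iff.1 (hsub ω)⟩

end Plinth
end PermCartesian

theorem mainTheorem1 {Ω : Type*} [Finite Ω] (G : Subgroup (Equiv.Perm Ω))
    (hG : MulAction.IsPretransitive G Ω) (E : Set (Setoid Ω))
    (hE : PermCartesian.IsCartesianDecomposition E)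
    (hhom : PermCartesian.IsHomogeneous E) (hinv : PermCartesian.IsInvariant G E)
    (r₀ : Setoid Ω) (hr₀ : r₀ ∈ E) :
    (PermCartesian.IsBlowUp G E → MulAction.IsQuasiPreprimitive G Ω →
      MulAction.IsQuasiPreprimitive (PermCartesian.component G r₀) (Quotient r₀) ∧
      PermCartesian.permSocle G = PermCartesian.directProduct E
        (fun r => PermCartesian.permSocle (PermCartesian.component G r))) ∧
    (PermCartesian.IsBlowUp G E →
      MulAction.IsQuasiPreprimitive (PermCartesian.component G r₀) (Quotient r₀) →
      ¬ PermCartesian.IsQuasiprimitiveHA (PermCartesian.component G r₀) →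
      MulAction.IsQuasiPreprimitive G Ω ∧
      PermCartesian.permSocle G = PermCartesian.directProduct E
        (fun r => PermCartesian.permSocle (PermCartesian.component G r))) ∧
    ¬ PermCartesian.IsQuasiprimitiveSd G ∧
    (PermCartesian.IsQuasiprimitiveCd G →
      PermCartesian.IsBlowUp G E ∧
      (PermCartesian.IsQuasiprimitiveSd (PermCartesian.component G r₀) ∨
        PermCartesian.IsQuasiprimitiveCd (PermCartesian.component G r₀))) := by
  have hΩ := hE.nonempty hr₀
  refine ⟨fun hblow hq => ?_, fun hblow hq hHA => ?_, ?_, ?_⟩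
  · obtain ⟨M, h⟩ := hblow.exists_via
    refine ⟨h.isQuasiPreprimitive_component hr₀ hq, ?_⟩
    rw [← h.eq_directProduct_permSocle]
    -- Without abelian minimal normal subgroups in the component `C_G(M)` is trivial; otherwise `M`
    -- is abelian and self-centralising.
    by_cases hna : ∀ A, PermCartesian.MinNormalIn A (PermCartesian.component G r₀) →
      ¬ A ≤ Subgroup.centralizer (A : Set (Equiv.Perm (Quotient r₀)))
    · exact h.permSocle_eq_of_nonabelian hr₀ hna
    · push Not at hna
      obtain ⟨A, hA, hcomm⟩ := hna
      exact h.permSocle_eq_of_abelian hr₀ hq hA hcomm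
  · obtain ⟨M, h⟩ := hblow.exists_via
    have : Nonempty (Quotient r₀) := hΩ.map (Quotient.mk r₀)
    have hna : ∀ A, PermCartesian.MinNormalIn A (PermCartesian.component G r₀) →
        ¬ A ≤ Subgroup.centralizer (A : Set (Equiv.Perm (Quotient r₀))) := fun A hA hcomm =>
      hHA (PermCartesian.isQuasiprimitiveHA_of_minNormalIn hq hA hcomm)
    refine ⟨PermCartesian.isQuasiPreprimitive_iff.2 ⟨hG, fun N hN hN' =>
      h.isPretransitive_of_normalIn hr₀ hq hna hN hN'⟩, ?_⟩
    rw [← h.eq_directProduct_permSocle]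
    exact h.permSocle_eq_of_nonabelian hr₀ hna
  · rintro ⟨hq, M, hM, hcomm, -, -, hstab⟩
    obtain ⟨ω⟩ := hΩ
    exact (hM.isSubdirectPlinth hcomm hq (fun ω => (hstab ω).2) hE hhom
      hinv).not_isSimpleGroup_stabilizer hr₀ ω (hstab ω).1
  · rintro ⟨hq, M, hM, hcomm, -, -, hstab⟩
    have h := hM.isSubdirectPlinth hcomm hq (fun ω => (hstab ω).2) hE hhom hinv
    exact ⟨h.isBlowUp, h.isQuasiprimitive_component hr₀⟩
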